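/- Conventions. For a finitely generated free abelian group $\Lambda$ put $V=\Lambda\otimes_{\mathbb Z}\mathbb R$. A cone in $V$ is a set $\sigma=\{x\in V: f_i(x)=0,\ g_j(x)\ge 0 \text{ for all } i,j\}$ with finitely many $f_i,g_j\in\Lambda^\vee=\operatorname{Hom}(\Lambda,\mathbb Z)$; a face of $\sigma$ is obtained by changing some (maybe none) of the inequalities in such a description into equalities. Let $V_\sigma$ be the linear span of $\sigma$, $\Lambda_\sigma=V_\sigma\cap\Lambda$, $\dim\sigma=\dim V_\sigma$, and let the interior of $\sigma$ be its interior as a subset of $V_\sigma$. A fan in $V$ is a finite set $X$ of cones that contains all faces of its cones and in which any two cones intersect in a common face; $|X|$ is the union of its cones and its dimension is the maximal dimension of its cones (the empty fan is allowed and has dimension $-\infty$). A tropical fan of dimension $n\ge 0$ is a fan $X$ of dimension $n$ all of whose inclusion-maximal cones have dimension $n$, together with weights $\omega_X(\sigma)\in\mathbb Z_{>0}$ for the $n$-dimensional cones $\sigma\in X$, such that for every $(n-1)$-dimensional cone $\tau\in X$ one has $\sum_{\sigma}\omega_X(\sigma)\,u_{\sigma/\tau}=0$ in $V/V_\tau$;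 here $\sigma$ runs over the $n$-dimensional cones of $X$ having $\tau$ as a face, and $u_{\sigma/\tau}$ is the generator of $\Lambda_\sigma/\Lambda_\tau\cong\mathbb Z$ lying on the same side of $V_\tau$ as $\sigma$. A tropical fan $Y$ in $V$ is irreducible if there is no tropical fan $Z$ in $V$ of the same dimension with $|Z|\subsetneq|Y|$. A morphism $f:X\to Y$ of fans in $V=\Lambda\otimes\mathbb R$ and $V'=\Lambda'\otimes\mathbb R$ is a map $|X|\to|Y|$ induced by a homomorphism $\Lambda\to\Lambda'$, which (as well as the induced linear map $V\to V'$) is also denoted $f$. Corollary. Let $X$ and $Y$ be tropical fans of the same dimension $n$ in $V=\Lambda\otimes\mathbb R$ and $V'=\Lambda'\otimes\mathbb R$, respectively, and let $f:X\to Y$ be a morphism. Assume that $Y$ is irreducible. Then there is a fan $Y_0$ in $V'$ of dimension smaller than $n$ with $|Y_0|\subset|Y|$ such that (a) each point $Q\in|Y|\setminus|Y_0|$ lies in the interior of a (unique) cone $\sigma'_Q\in Y$ of dimension $n$; (b) each point $P\in f^{-1}(|Y|\setminus|Y_0|)\subset|X|$ lies in the interior of a (unique) cone $\sigma_P\in X$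 of dimension $n$; (c) for $Q\in|Y|\setminus|Y_0|$ the set $\{P\in|X|:f(P)=Q\}$ is finite, for each $P$ in it $f(\Lambda_{\sigma_P})$ is a subgroup of finite index in $\Lambda'_{\sigma'_Q}$, and the sum $$\sum_{P\in|X|:\,f(P)=Q}\operatorname{mult}_P f,\qquad \operatorname{mult}_P f:=\frac{\omega_X(\sigma_P)}{\omega_Y(\sigma'_Q)}\cdot\bigl|\Lambda'_{\sigma'_Q}/f(\Lambda_{\sigma_P})\bigr|,$$ does not depend on $Q$. -/

import Mathlib

open scoped TensorProduct

namespace TropicalFans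

/-- The real vector space `V = Λ ⊗ ℝ` attached to a lattice `Λ`. -/
abbrev VSpace (Λ : Type*) [AddCommGroup Λ] : Type _ := ℝ ⊗[ℤ] Λ

section Cones

variable {Λ : Type*} [AddCommGroup Λ]

/-- The canonical map `Λ → V`, `x ↦ 1 ⊗ x`, through which `Λ` is a lattice in `V`. -/
noncomputable def latticeIncl (Λ : Type*) [AddCommGroup Λ] : Λ →ₗ[ℤ] VSpace Λ :=
  TensorProduct.mk ℤ ℝ Λ 1

/-- An element of the dual lattice, viewed as a linear form on `V`. -/
noncomputable def realForm (g : Module.Dual ℤ Λ) : VSpace Λ →ₗ[ℝ] ℝ :=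
  Module.Dual.baseChange ℝ g

/-- The subset of `V` where all `f ∈ F` vanish and all `g ∈ G` are non-negative. -/
def solutionSet (F G : Finset (Module.Dual ℤ Λ)) : Set (VSpace Λ) :=
  {x | (∀ f ∈ F, realForm f x = 0) ∧ (∀ g ∈ G, 0 ≤ realForm g x)}

/-- Cones: subsets of `V` given by finitely many integral linear equalities and non-strict
inequalities. -/
def IsCone (σ : Set (VSpace Λ)) : Prop :=
  ∃ F G : Finset (Module.Dual ℤ Λ), σ = solutionSet F G

/-- `τ ≤ σ`: in a presentation of the cone `σ` some (maybe none) of the inequalities are changed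
to equalities. -/
def IsFace (τ σ : Set (VSpace Λ)) : Prop :=
  ∃ F G J : Finset (Module.Dual ℤ Λ), J ⊆ G ∧ σ = solutionSet F G ∧
    τ = {x ∈ solutionSet F G | ∀ g ∈ J, realForm g x = 0}

/-- The linear span `V_σ` of a cone. -/
def coneSpan (σ : Set (VSpace Λ)) : Submodule ℝ (VSpace Λ) := Submodule.span ℝ σ

/-- The lattice `Λ_σ = V_σ ∩ Λ`. -/
noncomputable def coneLattice (σ : Set (VSpace Λ)) : Submodule ℤ Λ :=
  ((coneSpan σ).restrictScalars ℤ).comap (latticeIncl Λ)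

/-- The dimension of a cone, `dim V_σ`. -/
noncomputable def coneDim (σ : Set (VSpace Λ)) : ℕ := Module.finrank ℝ (coneSpan σ)

/-- The interior of a cone `σ`, taken inside its span `V_σ`: the points of `σ` from which one can
move a little in each direction of `V_σ` without leaving `σ`. (For a convex set in a
finite-dimensional space this is the topological interior relative to `V_σ`.) -/
def coneInterior (σ : Set (VSpace Λ)) : Set (VSpace Λ) :=
  {x ∈ σ | ∀ v ∈ coneSpan σ, ∃ ε : ℝ, 0 < ε ∧ x + ε • v ∈ σ}

/-- `u ∈ Λ` represents the primitive normal vector `u_{σ/τ} ∈ Λ_σ / Λ_τ`, where `τ` is a face of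
`σ` of codimension one: it generates `Λ_σ / Λ_τ` and lies on the side of `V_τ` that contains
`σ`, that is, on the positive side of an integral form that vanishes on `τ` and is non-negative
on `σ`. -/
def IsNormalVector (σ τ : Set (VSpace Λ)) (u : Λ) : Prop :=
  coneLattice τ ⊔ Submodule.span ℤ {u} = coneLattice σ ∧
  ∃ g : Module.Dual ℤ Λ, (∀ x ∈ τ, realForm g x = 0) ∧ (∀ x ∈ σ, 0 ≤ realForm g x) ∧ 0 < g u

end Cones

/-- Fans in `V = Λ ⊗ ℝ`; the empty fan is allowed. -/
structure Fan (Λ : Type*) [AddCommGroup Λ] where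
  cones : Finset (Set (VSpace Λ))
  isCone : ∀ σ ∈ cones, IsCone σ
  face_mem : ∀ σ ∈ cones, ∀ τ, IsFace τ σ → τ ∈ cones
  inter_face : ∀ σ ∈ cones, ∀ ρ ∈ cones, IsFace (σ ∩ ρ) σ ∧ IsFace (σ ∩ ρ) ρ

/-- The biggest dimension of a cone of the fan; it is `⊥` for the empty fan. -/
noncomputable def Fan.dim {Λ : Type*} [AddCommGroup Λ] (X : Fan Λ) : WithBot ℕ :=
  X.cones.sup fun σ => (coneDim σ : WithBot ℕ)

/-- The union `|X|` of all cones of the fan. -/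
def Fan.support {Λ : Type*} [AddCommGroup Λ] (X : Fan Λ) : Set (VSpace Λ) :=
  {x | ∃ σ ∈ X.cones, x ∈ σ}

/-- Weighted fans of pure dimension `n`: each inclusion-maximal cone has dimension `n`, and the
cones of dimension `n` carry positive integral weights. Only the values of `weight` on these cones
matter. As `n` is a natural number, a weighted fan has at least one cone. -/
structure WeightedFan (Λ : Type*) [AddCommGroup Λ] (n : ℕ) extends Fan Λ where
  dim_eq : toFan.dim = (n : WithBot ℕ)
  pure : ∀ σ, Maximal (fun ρ => ρ ∈ cones) σ → coneDim σ = n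
  weight : Set (VSpace Λ) → ℕ
  weight_pos : ∀ σ ∈ cones, coneDim σ = n → 0 < weight σ

open Classical in
/-- The cones of dimension `n` of the fan that have `τ` as a face. -/
noncomputable def Fan.star {Λ : Type*} [AddCommGroup Λ] (X : Fan Λ) (n : ℕ)
    (τ : Set (VSpace Λ)) : Finset (Set (VSpace Λ)) :=
  X.cones.filter fun σ => coneDim σ = n ∧ IsFace τ σ

/-- Tropical fans of dimension `n`: weighted fans with `∑_{σ > τ} ω(σ) u_{σ/τ} = 0` in `V / V_τ`
for every cone `τ` of dimension `n - 1`. The normal vectors are unique modulo `Λ_τ`, so that it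
does not matter which representatives `u σ` are used. -/
structure TropicalFan (Λ : Type*) [AddCommGroup Λ] (n : ℕ) extends WeightedFan Λ n where
  balanced : ∀ τ ∈ cones, coneDim τ + 1 = n →
    ∃ u : Set (VSpace Λ) → Λ, (∀ σ ∈ toFan.star n τ, IsNormalVector σ τ (u σ)) ∧
      ∑ σ ∈ toFan.star n τ, weight σ • latticeIncl Λ (u σ) ∈ coneSpan τ

/-- A tropical fan is irreducible if the support of no tropical fan of the same dimension is
properly contained in its support. -/
def TropicalFan.Irreducible {Λ : Type*} [AddCommGroup Λ] {n : ℕ} (X : TropicalFan Λ n) : Prop :=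
  ¬ ∃ Z : TropicalFan Λ n, Z.support ⊂ X.support

section Morphisms

variable {Λ Λ' : Type*} [AddCommGroup Λ] [AddCommGroup Λ']

/-- The linear map `V → V'` induced by a homomorphism `Λ → Λ'`. -/
noncomputable def realMap (f : Λ →ₗ[ℤ] Λ') : VSpace Λ →ₗ[ℝ] VSpace Λ' := f.baseChange ℝ

/-- `f : Λ → Λ'` induces a morphism of fans `X → Y`, i.e. a map `|X| → |Y|`. -/
def IsMorphism (X : Fan Λ) (Y : Fan Λ') (f : Λ →ₗ[ℤ] Λ') : Prop :=
  ∀ x ∈ X.support, realMap f x ∈ Y.support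

/-- `σ` is a cone of dimension `n` of the fan that contains `P` in its interior. -/
def Fan.IsOpenCell (X : Fan Λ) (n : ℕ) (P : VSpace Λ) (σ : Set (VSpace Λ)) : Prop :=
  σ ∈ X.cones ∧ coneDim σ = n ∧ P ∈ coneInterior σ

/-- The cone `σ_P` of dimension `n` of the fan that contains `P` in its interior. It is unique if
it exists; otherwise the value is arbitrary. -/
noncomputable def Fan.cellAt (X : Fan Λ) (n : ℕ) (P : VSpace Λ) : Set (VSpace Λ) :=
  Classical.epsilon (X.IsOpenCell n P)

/-- The lattice index `|Λ'_{σ'} / f(Λ_σ)|`; it is `0` if it is infinite. -/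
noncomputable def latticeIndex (f : Λ →ₗ[ℤ] Λ') (σ : Set (VSpace Λ)) (σ' : Set (VSpace Λ')) : ℕ :=
  ((coneLattice σ).map f).toAddSubgroup.relIndex (coneLattice σ').toAddSubgroup

/-- The multiplicity
`mult_P f = ω_X(σ_P) / ω_Y(σ'_Q) * |Λ'_{σ'_Q} / f(Λ_{σ_P})|` of `f` at `P`, where `Q = f(P)`. -/
noncomputable def mult {n : ℕ} (X : WeightedFan Λ n) (Y : WeightedFan Λ' n) (f : Λ →ₗ[ℤ] Λ')
    (P : VSpace Λ) : ℚ :=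
  (X.weight (X.cellAt n P) : ℚ) / (Y.weight (Y.cellAt n (realMap f P)) : ℚ) *
    (latticeIndex f (X.cellAt n P) (Y.cellAt n (realMap f P)) : ℚ)

/-- The fibre of the morphism `|X| → |Y|` over `Q`. -/
def fibre (X : Fan Λ) (f : Λ →ₗ[ℤ] Λ') (Q : VSpace Λ') : Set (VSpace Λ) :=
  {P ∈ X.support | realMap f P = Q}

end Morphisms

end TropicalFans

/-!
The proof works with cells of hyperplane arrangements. For a finite set `H = -H` of integral forms,
the cell of a point `p` consists of the points at which all forms of `H` that are nonnegative at `p`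
are nonnegative. Each cone is a cell of some arrangement, the cells in a union of cells form a fan
(`cellFan`), and `q` lies in the cell of `p` exactly if the cell of `q` is a face of that of `p`.
Faces, interiors and spans of cones can therefore be read off from points.

There is an arrangement in the target, adapted to `f` and to the identity of `Y`, such that the
images of the spans of cones, and the images of the cones on whose span the map is injective, are
unions of cells (`exists_isAdapted`). The cells in `|Y|` of dimension less than `n` form `Y₀`. Over
the other points `Q`, a cone of `X` that contains a preimage contains it in its interior, and `f`
maps the span of this cone isomorphically onto that of the cell of `Q` (`IsAdapted.isOpenCell`). So
the fibre over `Q` corresponds to the `n`-dimensional cones whose image contains the cell of `Q`.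
The weighted count of the preimages is thus the quotient of the push-forward weight `pushWeight` of
this cell by the weight of `Y` (`IsAdapted.finsum_mult`).

The push-forward weights are balanced (`pushWeight_balanced`). Around a cell `D` of dimension
`n - 1`, a cone `σ` whose interior meets the fibre over a point of the relative interior of `D`
contributes to two opposite cells, and these contributions cancel. If the fibre meets a facet `τ` of
`σ` instead, multiplicativity of lattice indices turns the contribution into the lattice index of
`τ` times the image of the normal vector of `σ`. Summing over all `σ` around `τ` gives zero by the
balancing of `X`. For the identity of `Y` the push-forward weights are the weights of `Y`.

Finally, as `Y` is irreducible, the two systems of weights on the cells of `|Y|` are proportional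
(`TropicalFan.Irreducible.exists_pushWeight_eq`): otherwise a balanced linear combination with
nonnegative values would vanish on some cells but not on all, and its support
(`exists_tropicalFan_of_balanced`) would be too small.
-/

namespace TropicalFans

/-! ### Lattices and rational subspaces -/

section Lattice

variable {Λ Λ' : Type*} [AddCommGroup Λ] [AddCommGroup Λ']

theorem latticeIncl_apply (l : Λ) : latticeIncl Λ l = (1 : ℝ) ⊗ₜ[ℤ] l := rfl

@[simp]
theorem realForm_latticeIncl (g : Module.Dual ℤ Λ) (l : Λ) :
    realForm g (latticeIncl Λ l) = (g l : ℝ) := by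
  simp [realForm, latticeIncl_apply]

@[simp]
theorem realMap_latticeIncl (f : Λ →ₗ[ℤ] Λ') (l : Λ) :
    realMap f (latticeIncl Λ l) = latticeIncl Λ' (f l) := by
  simp [realMap, latticeIncl_apply]

@[simp]
theorem realForm_neg (g : Module.Dual ℤ Λ) (x : VSpace Λ) :
    realForm (-g) x = -realForm g x := by
  simp [realForm, map_neg]

theorem realForm_sum (S : Finset (Module.Dual ℤ Λ)) (x : VSpace Λ) :
    realForm (∑ g ∈ S, g) x = ∑ g ∈ S, realForm g x := by
  simp [realForm, map_sum]

/-- The sublattice on which all forms of `S` vanish. -/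
def commonKer (S : Finset (Module.Dual ℤ Λ)) : Submodule ℤ Λ :=
  LinearMap.ker (LinearMap.pi fun h : S => (h : Λ →ₗ[ℤ] ℤ))

theorem mem_commonKer {S : Finset (Module.Dual ℤ Λ)} {l : Λ} :
    l ∈ commonKer S ↔ ∀ h ∈ S, h l = 0 := by
  simp [commonKer, funext_iff]

/-- A subspace cut out by integral forms is spanned by its lattice points, as `ℝ` is flat
over `ℤ`. -/
theorem mem_baseChange_commonKer {S : Finset (Module.Dual ℤ Λ)} {x : VSpace Λ}
    (hx : ∀ h ∈ S, realForm h x = 0) : x ∈ (commonKer S).baseChange ℝ := by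
  classical
  set φ : Λ →ₗ[ℤ] (S → ℤ) := LinearMap.pi fun h : S => (h : Λ →ₗ[ℤ] ℤ)
  have hex := Module.Flat.lTensor_exact ℝ (φ.exact_subtype_ker_map)
  have h0 : φ.lTensor ℝ x = 0 := by
    apply (TensorProduct.piScalarRight ℤ ℤ ℝ S).injective
    rw [map_zero]
    funext h
    refine Eq.trans ?_ (hx h h.2)
    clear hx
    induction x using TensorProduct.induction_on with
    | zero => simp
    | add x y hx hy => rw [map_add, map_add, map_add, Pi.add_apply, hx, hy]
    | tmul r l => simp [φ, realForm]
  exact (hex x).1 h0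

theorem baseChange_span_le {L : Submodule ℤ Λ} {W : Submodule ℝ (VSpace Λ)}
    (h : ∀ l ∈ L, latticeIncl Λ l ∈ W) : L.baseChange ℝ ≤ W := by
  rw [Submodule.baseChange_eq_span, Submodule.span_le]
  rintro _ ⟨l, hl, rfl⟩
  exact h l hl

theorem latticeIncl_mem_baseChange {L : Submodule ℤ Λ} {l : Λ} (hl : l ∈ L) :
    latticeIncl Λ l ∈ L.baseChange ℝ :=
  Submodule.tmul_mem_baseChange_of_mem 1 hl

/-- A lattice vector in the real span of a sublattice has a multiple in the sublattice: otherwise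
it spans a copy of `ℤ` in the quotient, which survives the flat base change to `ℝ`. -/
theorem exists_smul_mem_of_latticeIncl_mem {L : Submodule ℤ Λ} {l : Λ}
    (h : latticeIncl Λ l ∈ L.baseChange ℝ) : ∃ N : ℤ, N ≠ 0 ∧ N • l ∈ L := by
  by_contra! hN
  let ψ : ℤ →ₗ[ℤ] Λ ⧸ L := LinearMap.toSpanSingleton ℤ _ (L.mkQ l)
  have hψ : Function.Injective ψ := by
    rw [← LinearMap.ker_eq_bot, LinearMap.ker_eq_bot']
    intro N h0
    by_contra hne
    refine hN N hne ?_
    rw [← Submodule.Quotient.mk_eq_zero]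
    simpa [ψ] using h0
  have hinj := Module.Flat.lTensor_preserves_injective_linearMap (M := ℝ) ψ hψ
  have hz : L.mkQ.baseChange ℝ (latticeIncl Λ l) = 0 := by
    have hle : L.baseChange ℝ ≤ LinearMap.ker (L.mkQ.baseChange ℝ) := by
      apply baseChange_span_le
      intro k hk
      simp [latticeIncl_apply, (Submodule.Quotient.mk_eq_zero L).2 hk]
    exact hle h
  have h1 : (1 : ℝ) ⊗ₜ[ℤ] (1 : ℤ) = 0 := by
    apply hinj
    rw [map_zero, ← hz]
    simp [ψ, latticeIncl_apply]
  have h2 := congrArg (TensorProduct.rid ℤ ℝ) h1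
  simp at h2

/-- Integral forms separate a sublattice from each vector none of whose multiples lies in it. -/
theorem exists_form_of_forall_smul_notMem [Module.Free ℤ Λ] [Module.Finite ℤ Λ]
    {L : Submodule ℤ Λ} {m : Λ} (hm : ∀ N : ℤ, N ≠ 0 → N • m ∉ L) :
    ∃ φ : Module.Dual ℤ Λ, (∀ l ∈ L, φ l = 0) ∧ φ m ≠ 0 := by
  -- modulo `L` and torsion the lattice is free, and there forms separate points
  let Q := (Λ ⧸ L) ⧸ Submodule.torsion ℤ (Λ ⧸ L)
  let π : Λ →ₗ[ℤ] Q := (Submodule.torsion ℤ (Λ ⧸ L)).mkQ ∘ₗ L.mkQ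
  have hfree : Module.Free ℤ Q := inferInstance
  have hπ : π m ≠ 0 := by
    intro h0
    have h1 : L.mkQ m ∈ Submodule.torsion ℤ (Λ ⧸ L) := by
      rw [← Submodule.Quotient.mk_eq_zero]; exact h0
    obtain ⟨⟨N, hN⟩, h2⟩ := (Submodule.mem_torsion_iff _).1 h1
    refine hm N (nonZeroDivisors.ne_zero hN) ?_
    rw [← Submodule.Quotient.mk_eq_zero]
    simpa using h2
  have : ∃ χ : Module.Dual ℤ Q, χ (π m) ≠ 0 := by
    by_contra! hall
    exact hπ ((Module.forall_dual_apply_eq_zero_iff ℤ (π m)).1 hall)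
  obtain ⟨χ, hχ⟩ := this
  refine ⟨χ ∘ₗ π, fun l hl => ?_, hχ⟩
  have : L.mkQ l = 0 := (Submodule.Quotient.mk_eq_zero L).2 hl
  simp only [LinearMap.comp_apply, π, this, map_zero]

/-- The real span of a sublattice is cut out by finitely many integral forms. -/
theorem exists_forms_baseChange [Module.Free ℤ Λ] [Module.Finite ℤ Λ]
    (L : Submodule ℤ Λ) :
    ∃ S : Finset (Module.Dual ℤ Λ), ∀ x, x ∈ L.baseChange ℝ ↔ ∀ h ∈ S, realForm h x = 0 := by
  let A : Submodule ℤ (Module.Dual ℤ Λ) := L.dualAnnihilator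
  obtain ⟨S, hS⟩ : A.FG := IsNoetherian.noetherian A
  refine ⟨S, fun x => ⟨fun hx h hh => ?_, fun hx => ?_⟩⟩
  · have hA : h ∈ A := hS ▸ Submodule.subset_span hh
    have hle : L.baseChange ℝ ≤ LinearMap.ker (realForm h) := by
      apply baseChange_span_le
      intro l hl
      simp [(Submodule.mem_dualAnnihilator h).1 hA l hl]
    exact hle hx
  · refine baseChange_span_le (fun l hl => ?_) (mem_baseChange_commonKer hx)
    rw [mem_commonKer] at hl
    have hA : ∀ h ∈ A, h l = 0 := by
      intro h hh
      have hle : A ≤ LinearMap.ker (Module.Dual.eval ℤ Λ l) := by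
        rw [← hS, Submodule.span_le]
        intro k hk
        exact hl k hk
      exact hle hh
    have : ∃ N : ℤ, N ≠ 0 ∧ N • l ∈ L := by
      by_contra! hN
      obtain ⟨φ, h1, h2⟩ := exists_form_of_forall_smul_notMem hN
      exact h2 (hA φ ((Submodule.mem_dualAnnihilator φ).2 h1))
    obtain ⟨N, hN, hNl⟩ := this
    have h1 := latticeIncl_mem_baseChange hNl
    rw [map_zsmul, ← Int.cast_smul_eq_zsmul ℝ] at h1
    exact (Submodule.smul_mem_iff _ (Int.cast_ne_zero.2 hN)).1 h1

/-- Along a homomorphism that is injective on a sublattice `L`, each form on `L` extends to the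
target after multiplication by a positive integer. The form comes from separating the graph of
`g` over `f` from the second coordinate axis of `Λ' × ℤ`. -/
theorem exists_form_comp_eq_smul [Module.Free ℤ Λ'] [Module.Finite ℤ Λ'] (f : Λ →ₗ[ℤ] Λ')
    (L : Submodule ℤ Λ) (hf : ∀ l ∈ L, f l = 0 → l = 0) (g : Module.Dual ℤ Λ) :
    ∃ (k : Module.Dual ℤ Λ') (N : ℤ), 0 < N ∧ ∀ l ∈ L, k (f l) = N * g l := by
  have key : ∀ N : ℤ, N ≠ 0 → N • ((0, 1) : Λ' × ℤ) ∉ L.map (f.prod g) := by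
    rintro N hN ⟨l, hl, h⟩
    have h1 : f l = 0 := by simpa using congrArg Prod.fst h
    have h2 : g l = N := by simpa using congrArg Prod.snd h
    rw [hf l hl h1, map_zero] at h2
    exact hN h2.symm
  obtain ⟨φ, h1, h2⟩ := exists_form_of_forall_smul_notMem key
  have h3 : ∀ l ∈ L, φ (f l, 0) = -φ (0, 1) * g l := by
    intro l hl
    have h4 := h1 _ ⟨l, hl, rfl⟩
    have h5 : (f.prod g) l = (f l, 0) + g l • ((0, 1) : Λ' × ℤ) := by simp
    rw [h5, map_add, map_smul, smul_eq_mul] at h4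
    linarith
  let k : Module.Dual ℤ Λ' := φ ∘ₗ LinearMap.inl ℤ Λ' ℤ
  rcases lt_or_gt_of_ne h2 with hneg | hpos
  · exact ⟨k, -φ (0, 1), by linarith, fun l hl => h3 l hl⟩
  · exact ⟨-k, φ (0, 1), hpos, fun l hl => by
      have : k (f l) = φ (f l, 0) := rfl
      rw [LinearMap.neg_apply, this, h3 l hl]; ring⟩

end Lattice

/-! ### Cells of an arrangement of rational hyperplanes -/

section Cells

variable {Λ : Type*} [AddCommGroup Λ]

/-- A set of forms that is closed under negation. It stands for the arrangement of the hyperplanes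
on which its members vanish. -/
def IsSymmForms (H : Finset (Module.Dual ℤ Λ)) : Prop := ∀ h ∈ H, -h ∈ H

/-- The closed cell of the arrangement `H` that contains `p` in its relative interior, provided that
`H` is closed under negation: a form of `H` that vanishes at `p` then vanishes on the cell. -/
def cell (H : Finset (Module.Dual ℤ Λ)) (p : VSpace Λ) : Set (VSpace Λ) :=
  {x | ∀ h ∈ H, 0 ≤ realForm h p → 0 ≤ realForm h x}

/-- A set that is a union of closed cells of the arrangement `H`. -/
def IsCellClosed (H : Finset (Module.Dual ℤ Λ)) (S : Set (VSpace Λ)) : Prop :=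
  ∀ q ∈ S, cell H q ⊆ S

variable {H : Finset (Module.Dual ℤ Λ)} {p q : VSpace Λ} {σ τ : Set (VSpace Λ)}

theorem self_mem_cell : p ∈ cell H p := fun _ _ h => h

theorem cell_subset_of_mem (hq : q ∈ cell H p) : cell H q ⊆ cell H p :=
  fun _ hx h hh h0 => hx h hh (hq h hh h0)

theorem cell_anti {H' : Finset (Module.Dual ℤ Λ)} (hH : H ⊆ H') : cell H' p ⊆ cell H p :=
  fun _ hx h hh h0 => hx h (hH hh) h0

theorem IsCellClosed.mono {H' : Finset (Module.Dual ℤ Λ)} {S : Set (VSpace Λ)}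
    (hS : IsCellClosed H S) (hH : H ⊆ H') : IsCellClosed H' S :=
  fun q hq => (cell_anti hH).trans (hS q hq)

theorem realForm_eq_zero_of_mem_cell (hH : IsSymmForms H) {x : VSpace Λ} (hx : x ∈ cell H p)
    {h : Module.Dual ℤ Λ} (hh : h ∈ H) (h0 : realForm h p = 0) : realForm h x = 0 := by
  have h1 := hx h hh h0.ge
  have h2 := hx (-h) (hH h hh) (by simp [h0])
  rw [realForm_neg] at h2
  linarith

theorem realForm_nonpos_of_mem_cell (hH : IsSymmForms H) {x : VSpace Λ} (hx : x ∈ cell H p)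
    {h : Module.Dual ℤ Λ} (hh : h ∈ H) (h0 : realForm h p ≤ 0) : realForm h x ≤ 0 := by
  have h2 := hx (-h) (hH h hh) (by simpa using h0)
  rw [realForm_neg] at h2
  linarith

theorem isCone_cell : IsCone (cell H p) := by
  classical
  refine ⟨∅, H.filter fun h => 0 ≤ realForm h p, ?_⟩
  ext x
  simp [cell, solutionSet]

theorem IsCone.zero_mem (hσ : IsCone σ) : (0 : VSpace Λ) ∈ σ := by
  obtain ⟨F, G, rfl⟩ := hσ
  simp [solutionSet]

theorem IsCone.add_mem (hσ : IsCone σ) {x y : VSpace Λ} (hx : x ∈ σ) (hy : y ∈ σ) :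
    x + y ∈ σ := by
  obtain ⟨F, G, rfl⟩ := hσ
  refine ⟨fun f hf => ?_, fun g hg => ?_⟩
  · rw [map_add, hx.1 f hf, hy.1 f hf, add_zero]
  · rw [map_add]; exact add_nonneg (hx.2 g hg) (hy.2 g hg)

theorem IsCone.smul_mem (hσ : IsCone σ) {x : VSpace Λ} (hx : x ∈ σ) {a : ℝ} (ha : 0 ≤ a) :
    a • x ∈ σ := by
  obtain ⟨F, G, rfl⟩ := hσ
  refine ⟨fun f hf => ?_, fun g hg => ?_⟩
  · rw [map_smul, hx.1 f hf, smul_zero]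
  · rw [map_smul]; exact mul_nonneg ha (hx.2 g hg)

open Filter Topology in
/-- Strict signs of finitely many forms at `p` persist after a small move in any direction. -/
theorem eventually_strict_signs (H : Finset (Module.Dual ℤ Λ)) (p v : VSpace Λ) :
    ∀ᶠ δ in 𝓝[>] (0 : ℝ), ∀ h ∈ H, (0 < realForm h p → 0 < realForm h (p + δ • v)) ∧
      (realForm h p < 0 → realForm h (p + δ • v) < 0) := by
  rw [Filter.eventually_all_finset]
  intro h _
  have hc : Tendsto (fun δ : ℝ => realForm h (p + δ • v)) (𝓝[>] 0) (𝓝 (realForm h p)) := by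
    have : Continuous fun δ : ℝ => realForm h p + δ * realForm h v := by fun_prop
    have h2 := this.tendsto 0
    simp only [zero_mul, add_zero] at h2
    simpa using h2.mono_left nhdsWithin_le_nhds
  refine Filter.Eventually.and ?_ ?_
  · rw [eventually_imp_distrib_left]
    exact fun h0 => hc.eventually (lt_mem_nhds h0)
  · rw [eventually_imp_distrib_left]
    exact fun h0 => hc.eventually (gt_mem_nhds h0)

open Filter Topology in
theorem eventually_add_smul_mem_cell {v : VSpace Λ}
    (hv : ∀ h ∈ H, realForm h p = 0 → realForm h v = 0) :
    ∀ᶠ δ in 𝓝[>] (0 : ℝ), p + δ • v ∈ cell H p := by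
  filter_upwards [eventually_strict_signs H p v] with δ hδ h hh h0
  rcases h0.eq_or_lt with h1 | h1
  · rw [map_add, map_smul, hv h hh h1.symm, ← h1]; simp
  · exact ((hδ h hh).1 h1).le

theorem mem_coneSpan_cell (hH : IsSymmForms H) {x : VSpace Λ} :
    x ∈ coneSpan (cell H p) ↔ ∀ h ∈ H, realForm h p = 0 → realForm h x = 0 := by
  refine ⟨fun hx h hh h0 => ?_, fun hx => ?_⟩
  · have hle : coneSpan (cell H p) ≤ LinearMap.ker (realForm h) :=
      Submodule.span_le.2 fun y hy => realForm_eq_zero_of_mem_cell hH hy hh h0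
    exact hle hx
  · obtain ⟨δ, hδ, hδ0⟩ := ((eventually_add_smul_mem_cell hx).and self_mem_nhdsWithin).exists
    have h1 := (coneSpan (cell H p)).sub_mem (Submodule.subset_span hδ)
      (Submodule.subset_span self_mem_cell)
    rw [add_sub_cancel_left] at h1
    exact (Submodule.smul_mem_iff _ (ne_of_gt hδ0)).1 h1

theorem self_mem_coneInterior_cell (hH : IsSymmForms H) : p ∈ coneInterior (cell H p) := by
  refine ⟨self_mem_cell, fun v hv => ?_⟩
  obtain ⟨δ, hδ, hδ0⟩ := ((eventually_add_smul_mem_cell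
    ((mem_coneSpan_cell hH).1 hv)).and self_mem_nhdsWithin).exists
  exact ⟨δ, hδ0, hδ⟩

/-- A convex cone on which each form of `H` has constant sign contains a point at which only those
forms vanish that vanish on the whole cone. -/
theorem exists_generic_point {K : Set (VSpace Λ)} (h0 : 0 ∈ K)
    (hadd : ∀ x ∈ K, ∀ y ∈ K, x + y ∈ K) (H : Finset (Module.Dual ℤ Λ))
    (hsign : ∀ h ∈ H, (∀ x ∈ K, 0 ≤ realForm h x) ∨ ∀ x ∈ K, realForm h x ≤ 0) :
    ∃ r ∈ K, ∀ h ∈ H, realForm h r = 0 → ∀ x ∈ K, realForm h x = 0 := by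
  classical
  induction H using Finset.induction_on with
  | empty => exact ⟨0, h0, by simp⟩
  | insert h H _ ih =>
    obtain ⟨r, hr, hrH⟩ := ih fun k hk => hsign k (Finset.mem_insert_of_mem hk)
    by_cases hz : ∀ x ∈ K, realForm h x = 0
    · refine ⟨r, hr, fun k hk => ?_⟩
      rcases Finset.mem_insert.1 hk with rfl | hk
      · exact fun _ => hz
      · exact hrH k hk
    · push Not at hz
      obtain ⟨y, hy, hy0⟩ := hz
      -- two values of the same sign cancel only if both vanish
      have aux : ∀ k ∈ insert h H, realForm k (r + y) = 0 →
          realForm k r = 0 ∧ realForm k y = 0 := by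
        intro k hk hk0
        rw [map_add] at hk0
        rcases hsign k hk with hs | hs
        · have := hs r hr; have := hs y hy; constructor <;> linarith
        · have := hs r hr; have := hs y hy; constructor <;> linarith
      refine ⟨r + y, hadd r hr y hy, fun k hk hk0 => ?_⟩
      have := aux k hk hk0
      rcases Finset.mem_insert.1 hk with rfl | hk
      · exact absurd this.2 hy0
      · exact hrH k hk this.1

/-- Each cone is a cell: take the arrangement of the forms in a presentation, and a point of the
cone at which as few of the inequalities as possible are equalities. -/
theorem exists_cell_eq (hσ : IsCone σ) :
    ∃ (H : Finset (Module.Dual ℤ Λ)) (p : VSpace Λ), IsSymmForms H ∧ σ = cell H p := by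
  classical
  have hadd : ∀ x ∈ σ, ∀ y ∈ σ, x + y ∈ σ := fun x hx y hy => hσ.add_mem hx hy
  have hzero := hσ.zero_mem
  obtain ⟨F, G, rfl⟩ := hσ
  obtain ⟨p, hp, hgen⟩ := exists_generic_point hzero hadd G fun g hg => Or.inl fun x hx => hx.2 g hg
  refine ⟨(F ∪ G) ∪ (F ∪ G).image Neg.neg, p, ?_, ?_⟩
  · intro h hh
    simp only [Finset.mem_union, Finset.mem_image] at hh ⊢
    rcases hh with hh | ⟨k, hk, rfl⟩
    · exact Or.inr ⟨h, hh, rfl⟩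
    · exact Or.inl (by simpa using hk)
  · have hF : ∀ x : VSpace Λ, (∀ f ∈ F, realForm f x = 0) → ∀ f ∈ F, 0 ≤ realForm f x ∧
        0 ≤ realForm (-f) x := fun x hx f hf => by simp [hx f hf]
    ext x
    refine ⟨fun hx h hh h0 => ?_, fun hx => ⟨fun f hf => ?_, fun g hg => ?_⟩⟩
    · simp only [Finset.mem_union, Finset.mem_image] at hh
      rcases hh with (hh | hh) | ⟨k, hk | hk, rfl⟩
      · exact (hF x hx.1 h hh).1
      · exact hx.2 h hh
      · exact (hF x hx.1 k hk).2
      · rw [realForm_neg] at h0 ⊢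
        have := hp.2 k hk
        rw [hgen k hk (by linarith) x hx, neg_zero]
    · have h1 := hx f (by simp [hf]) (hF p hp.1 f hf).1
      have h2 := hx (-f) (by simp [hf]) (hF p hp.1 f hf).2
      rw [realForm_neg] at h2
      linarith
    · exact hx g (by simp [hg]) (hp.2 g hg)

/-- Faces are exactly the subsets of a cone on which a nonnegative integral form vanishes. -/
theorem isFace_iff : IsFace τ σ ↔ IsCone σ ∧ ∃ g : Module.Dual ℤ Λ,
    (∀ x ∈ σ, 0 ≤ realForm g x) ∧ τ = {x ∈ σ | realForm g x = 0} := by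
  classical
  constructor
  · rintro ⟨F, G, J, hJ, rfl, rfl⟩
    have hnn : ∀ x ∈ solutionSet F G, ∀ g ∈ J, 0 ≤ realForm g x := fun x hx g hg => hx.2 g (hJ hg)
    refine ⟨⟨F, G, rfl⟩, ∑ g ∈ J, g, fun x hx => ?_, ?_⟩
    · rw [realForm_sum]
      exact Finset.sum_nonneg (hnn x hx)
    · ext x
      simp only [Set.mem_ofPred_eq, realForm_sum]
      refine and_congr_right fun hx => ?_
      rw [Finset.sum_eq_zero_iff_of_nonneg (hnn x hx)]
  · rintro ⟨⟨F, G, rfl⟩, g, hg, rfl⟩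
    have : solutionSet F G = solutionSet F (insert g G) := by
      ext x
      simp only [solutionSet, Set.mem_ofPred_eq, Finset.forall_mem_insert]
      exact ⟨fun h => ⟨h.1, hg x h, h.2⟩, fun h => ⟨h.1, h.2.2⟩⟩
    exact ⟨F, insert g G, {g}, by simp, this, by simp [← this]⟩

theorem IsFace.subset (h : IsFace τ σ) : τ ⊆ σ := by
  obtain ⟨-, g, -, rfl⟩ := isFace_iff.1 h
  exact Set.sep_subset _ _

/-- A cone inside a cell lies in the cell of one of its own points. -/
theorem exists_mem_subset_cell (hH : IsSymmForms H) {K : Set (VSpace Λ)} (hK : IsCone K)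
    (hKp : K ⊆ cell H p) :
    ∃ r ∈ K, ∀ x ∈ K, x ∈ cell H r := by
  have hs : ∀ h ∈ H, (∀ x ∈ K, 0 ≤ realForm h x) ∨ ∀ x ∈ K, realForm h x ≤ 0 := by
    intro h hh
    rcases le_total 0 (realForm h p) with h0 | h0
    · exact Or.inl fun x hx => hKp hx h hh h0
    · exact Or.inr fun x hx => realForm_nonpos_of_mem_cell hH (hKp hx) hh h0
  obtain ⟨r, hr, hgen⟩ := exists_generic_point hK.zero_mem
    (fun x hx y hy => hK.add_mem hx hy) H hs
  refine ⟨r, hr, fun x hx h hh h0 => ?_⟩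
  rcases hs h hh with h1 | h1
  · exact h1 x hx
  · exact (hgen h hh (le_antisymm (h1 r hr) h0) x hx).ge

/-- A supporting form is the sum of the forms that are nonnegative at `p` and vanish at `q`. -/
theorem isFace_cell_of_mem (hH : IsSymmForms H) (hq : q ∈ cell H p) :
    IsFace (cell H q) (cell H p) := by
  classical
  let J := H.filter fun h => 0 ≤ realForm h p ∧ realForm h q = 0
  refine isFace_iff.2 ⟨isCone_cell, ∑ h ∈ J, h, fun x hx => ?_, ?_⟩
  · rw [realForm_sum]
    refine Finset.sum_nonneg fun h hh => ?_
    rw [Finset.mem_filter] at hh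
    exact hx h hh.1 hh.2.1
  · ext x
    refine ⟨fun hx => ⟨cell_subset_of_mem hq hx, ?_⟩, fun hx h hh h0 => ?_⟩
    · rw [realForm_sum]
      refine Finset.sum_eq_zero fun h hh => ?_
      rw [Finset.mem_filter] at hh
      exact realForm_eq_zero_of_mem_cell hH hx hh.1 hh.2.2
    · obtain ⟨hx, hx0⟩ := hx
      rcases le_or_gt 0 (realForm h p) with h1 | h1
      · exact hx h hh h1
      · have hq0 : realForm (-h) q = 0 := by
          have h2 := realForm_nonpos_of_mem_cell hH hq hh h1.le
          rw [realForm_neg]; linarith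
        rw [realForm_sum, Finset.sum_eq_zero_iff_of_nonneg fun k hk => by
          rw [Finset.mem_filter] at hk; exact hx k hk.1 hk.2.1] at hx0
        have h3 := hx0 (-h) (Finset.mem_filter.2 ⟨hH h hh, by rw [realForm_neg]; linarith, hq0⟩)
        rw [realForm_neg] at h3
        linarith

theorem IsFace.isCone (h : IsFace τ σ) : IsCone τ := by
  classical
  obtain ⟨F, G, J, hJ, -, rfl⟩ := h
  refine ⟨F ∪ J, G, ?_⟩
  ext x
  simp only [solutionSet, Set.mem_ofPred_eq, Finset.mem_union]
  constructor
  · rintro ⟨⟨h1, h2⟩, h3⟩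
    exact ⟨fun f hf => hf.elim (h1 f) (h3 f), h2⟩
  · rintro ⟨h1, h2⟩
    exact ⟨⟨fun f hf => h1 f (Or.inl hf), h2⟩, fun f hf => h1 f (Or.inr hf)⟩

theorem isFace_cell_iff (hH : IsSymmForms H) :
    IsFace τ (cell H p) ↔ ∃ r ∈ cell H p, τ = cell H r := by
  constructor
  · intro hτ
    obtain ⟨r, hr, hsub⟩ := exists_mem_subset_cell hH hτ.isCone hτ.subset
    refine ⟨r, hτ.subset hr, Set.Subset.antisymm hsub fun x hx => ?_⟩
    have hxp := cell_subset_of_mem (hτ.subset hr) hx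
    obtain ⟨-, g, hg, rfl⟩ := isFace_iff.1 hτ
    refine ⟨hxp, le_antisymm ?_ (hg x hxp)⟩
    -- `r` lies in the relative interior, so one can move away from `x` a little
    obtain ⟨δ, hδ, hmem⟩ := (self_mem_coneInterior_cell (p := r) hH).2 (-x)
      (neg_mem (Submodule.subset_span hx))
    have h1 := hg _ (cell_subset_of_mem hr.1 hmem)
    rw [map_add, hr.2, map_smul, map_neg, smul_eq_mul] at h1
    nlinarith
  · rintro ⟨r, hr, rfl⟩
    exact isFace_cell_of_mem hH hr

theorem coneSpan_mono {σ τ : Set (VSpace Λ)} (h : σ ⊆ τ) : coneSpan σ ≤ coneSpan τ :=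
  Submodule.span_mono h

theorem coneLattice_mono {σ τ : Set (VSpace Λ)} (h : σ ⊆ τ) : coneLattice σ ≤ coneLattice τ :=
  fun _ hl => coneSpan_mono h hl

theorem mem_coneLattice {l : Λ} : l ∈ coneLattice σ ↔ latticeIncl Λ l ∈ coneSpan σ := Iff.rfl

/-- A point of the interior of a cone does not lie on a proper face. -/
theorem IsFace.eq_of_mem_coneInterior {P : VSpace Λ} (h : IsFace τ σ) (hP : P ∈ τ)
    (hPσ : P ∈ coneInterior σ) : τ = σ := by
  obtain ⟨-, g, hg, rfl⟩ := isFace_iff.1 h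
  refine Set.Subset.antisymm (Set.sep_subset _ _) fun x hx => ⟨hx, le_antisymm ?_ (hg x hx)⟩
  obtain ⟨δ, hδ, hmem⟩ := hPσ.2 (-x) (neg_mem (Submodule.subset_span hx))
  have h1 := hg _ hmem
  rw [map_add, hP.2, map_smul, map_neg, smul_eq_mul] at h1
  nlinarith

/-- A face is the intersection of the cone with the span of the face. -/
theorem IsFace.eq_inter_coneSpan (h : IsFace τ σ) : τ = σ ∩ coneSpan τ := by
  obtain ⟨-, g, hg, rfl⟩ := isFace_iff.1 h
  refine Set.Subset.antisymm (fun x hx => ⟨hx.1, Submodule.subset_span hx⟩) fun x hx => ⟨hx.1, ?_⟩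
  have hle : coneSpan {x ∈ σ | realForm g x = 0} ≤ LinearMap.ker (realForm g) :=
    Submodule.span_le.2 fun y hy => hy.2
  exact hle hx.2

theorem IsCone.exists_face_of_notMem_coneInterior (hσ : IsCone σ) {P : VSpace Λ} (hP : P ∈ σ)
    (hPσ : P ∉ coneInterior σ) : ∃ τ, IsFace τ σ ∧ P ∈ τ ∧ τ ≠ σ := by
  obtain ⟨H, p, hH, rfl⟩ := exists_cell_eq hσ
  refine ⟨cell H P, isFace_cell_of_mem hH hP, self_mem_cell, fun h => hPσ ?_⟩
  rw [← h]
  exact self_mem_coneInterior_cell hH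

theorem IsCone.exists_mem_coneInterior (hσ : IsCone σ) : ∃ P, P ∈ coneInterior σ := by
  obtain ⟨H, p, hH, rfl⟩ := exists_cell_eq hσ
  exact ⟨p, self_mem_coneInterior_cell hH⟩

/-- The span of a cone is a rational subspace: it is spanned by its lattice points. -/
theorem IsCone.baseChange_coneLattice (hσ : IsCone σ) :
    (coneLattice σ).baseChange ℝ = coneSpan σ := by
  classical
  obtain ⟨H, p, hH, rfl⟩ := exists_cell_eq hσ
  refine le_antisymm (baseChange_span_le fun l hl => hl) fun x hx => ?_
  have h1 : x ∈ (commonKer (H.filter fun h => realForm h p = 0)).baseChange ℝ := by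
    apply mem_baseChange_commonKer
    intro h hh
    rw [Finset.mem_filter] at hh
    exact (mem_coneSpan_cell hH).1 hx h hh.1 hh.2
  refine Submodule.baseChange_mono ℝ (fun l hl => ?_) h1
  rw [mem_coneLattice, mem_coneSpan_cell hH]
  intro h hh h0
  rw [realForm_latticeIncl, (mem_commonKer.1 hl) h (Finset.mem_filter.2 ⟨hh, h0⟩), Int.cast_zero]

section Dim

variable [Module.Finite ℤ Λ]

theorem coneDim_mono {σ τ : Set (VSpace Λ)} (h : σ ⊆ τ) : coneDim σ ≤ coneDim τ :=
  Submodule.finrank_mono (coneSpan_mono h)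

theorem coneSpan_eq_of_subset {σ τ : Set (VSpace Λ)} (h : σ ⊆ τ) (hd : coneDim τ ≤ coneDim σ) :
    coneSpan σ = coneSpan τ :=
  Submodule.eq_of_le_of_finrank_le (coneSpan_mono h) hd

theorem IsFace.eq_of_coneDim_le (h : IsFace τ σ) (hd : coneDim σ ≤ coneDim τ) : τ = σ := by
  rw [h.eq_inter_coneSpan, coneSpan_eq_of_subset h.subset hd]
  exact Set.inter_eq_left.2 Submodule.subset_span

theorem cell_eq_of_coneDim_le (hH : IsSymmForms H) (hq : q ∈ cell H p)
    (hd : coneDim (cell H p) ≤ coneDim (cell H q)) : cell H q = cell H p :=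
  (isFace_cell_of_mem hH hq).eq_of_coneDim_le hd

end Dim

/-- A cell is determined by the subset of forms that are nonnegative at its point. -/
theorem finite_setOf_cell (H : Finset (Module.Dual ℤ Λ)) (S : Set (VSpace Λ)) :
    {σ | ∃ p ∈ S, σ = cell H p}.Finite := by
  classical
  refine Set.Finite.subset ((H.powerset.finite_toSet).image
    fun A => {x : VSpace Λ | ∀ h ∈ A, 0 ≤ realForm h x}) ?_
  rintro _ ⟨p, -, rfl⟩
  refine ⟨H.filter fun h => 0 ≤ realForm h p, Finset.mem_powerset.2 (Finset.filter_subset _ _), ?_⟩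
  ext x
  simp [cell]

/-- The cells of the arrangement `H` that lie in a union `S` of cells form a fan. -/
noncomputable def cellFan (H : Finset (Module.Dual ℤ Λ)) (hH : IsSymmForms H) (S : Set (VSpace Λ))
    (hS : IsCellClosed H S) : Fan Λ where
  cones := (finite_setOf_cell H S).toFinset
  isCone σ hσ := by
    rw [Set.Finite.mem_toFinset] at hσ
    obtain ⟨p, -, rfl⟩ := hσ
    exact isCone_cell
  face_mem σ hσ τ hτ := by
    rw [Set.Finite.mem_toFinset] at hσ ⊢
    obtain ⟨p, hp, rfl⟩ := hσ
    obtain ⟨r, hr, rfl⟩ := (isFace_cell_iff hH).1 hτ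
    exact ⟨r, hS p hp hr, rfl⟩
  inter_face σ hσ ρ hρ := by
    classical
    rw [Set.Finite.mem_toFinset] at hσ hρ
    obtain ⟨p, hp, rfl⟩ := hσ
    obtain ⟨q, hq, rfl⟩ := hρ
    have hcone : IsCone (cell H p ∩ cell H q) := by
      obtain ⟨F, G, h1⟩ := isCone_cell (H := H) (p := p)
      obtain ⟨F', G', h2⟩ := isCone_cell (H := H) (p := q)
      refine ⟨F ∪ F', G ∪ G', ?_⟩
      rw [h1, h2]
      ext x
      simp only [solutionSet, Set.mem_inter_iff, Set.mem_ofPred_eq, Finset.mem_union, or_imp,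
        forall_and]
      tauto
    obtain ⟨r, hr, hsub⟩ := exists_mem_subset_cell hH hcone Set.inter_subset_left
    have heq : cell H p ∩ cell H q = cell H r := Set.Subset.antisymm hsub
      (Set.subset_inter (cell_subset_of_mem hr.1) (cell_subset_of_mem hr.2))
    rw [heq]
    exact ⟨isFace_cell_of_mem hH hr.1, isFace_cell_of_mem hH hr.2⟩

theorem mem_cellFan {hH : IsSymmForms H} {S : Set (VSpace Λ)} {hS : IsCellClosed H S} :
    σ ∈ (cellFan H hH S hS).cones ↔ ∃ p ∈ S, σ = cell H p := by
  simp [cellFan]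

theorem support_cellFan {hH : IsSymmForms H} {S : Set (VSpace Λ)} {hS : IsCellClosed H S} :
    (cellFan H hH S hS).support = S := by
  ext x
  refine ⟨?_, fun hx => ⟨cell H x, mem_cellFan.2 ⟨x, hx, rfl⟩, self_mem_cell⟩⟩
  rintro ⟨σ, hσ, hx⟩
  obtain ⟨p, hp, rfl⟩ := mem_cellFan.1 hσ
  exact hS p hp hx

end Cells

/-! ### Arrangements adapted to a linear map -/

section Adapted

variable {Λ Λ' : Type*} [AddCommGroup Λ] [AddCommGroup Λ']

theorem map_coneSpan_eq_baseChange {σ : Set (VSpace Λ)} (hσ : IsCone σ) (f : Λ →ₗ[ℤ] Λ') :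
    (coneSpan σ).map (realMap f) = ((coneLattice σ).map f).baseChange ℝ := by
  rw [← hσ.baseChange_coneLattice]
  refine le_antisymm ?_ (baseChange_span_le ?_)
  · rw [Submodule.map_le_iff_le_comap]
    refine baseChange_span_le fun l hl => ?_
    rw [Submodule.mem_comap, realMap_latticeIncl]
    exact latticeIncl_mem_baseChange ⟨l, hl, rfl⟩
  · rintro _ ⟨l, hl, rfl⟩
    exact ⟨latticeIncl Λ l, latticeIncl_mem_baseChange hl, realMap_latticeIncl f l⟩

theorem eq_zero_of_injOn {f : Λ →ₗ[ℤ] Λ'} {W : Submodule ℝ (VSpace Λ)}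
    (hf : Set.InjOn (realMap f) W) {x : VSpace Λ} (hx : x ∈ W) (h0 : realMap f x = 0) : x = 0 :=
  hf hx W.zero_mem (by rw [h0, map_zero])

theorem eq_zero_of_latticeIncl_eq_zero [Module.Free ℤ Λ] {l : Λ}
    (h : latticeIncl Λ l = 0) : l = 0 := by
  have h1 : latticeIncl Λ l ∈ (⊥ : Submodule ℤ Λ).baseChange ℝ := by rw [h]; exact zero_mem _
  obtain ⟨N, hN, h2⟩ := exists_smul_mem_of_latticeIncl_mem h1
  exact (smul_eq_zero.1 ((Submodule.mem_bot ℤ).1 h2)).resolve_left hN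

/-- The symmetric arrangement `H` of hyperplanes in the target is fine enough for the map `f` on the
fan `X`: the images of the spans of the cones of `X`, and the images of the cones on whose span `f`
is injective, are unions of cells. -/
structure IsAdapted (H : Finset (Module.Dual ℤ Λ')) (X : Fan Λ) (f : Λ →ₗ[ℤ] Λ') : Prop where
  symm : IsSymmForms H
  span : ∀ σ ∈ X.cones, IsCellClosed H (realMap f '' coneSpan σ)
  image : ∀ σ ∈ X.cones, Set.InjOn (realMap f) (coneSpan σ) → IsCellClosed H (realMap f '' σ)

theorem IsAdapted.mono {H H' : Finset (Module.Dual ℤ Λ')} {X : Fan Λ} {f : Λ →ₗ[ℤ] Λ'}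
    (h : IsAdapted H X f) (hH : H ⊆ H') (hs : IsSymmForms H') : IsAdapted H' X f :=
  ⟨hs, fun σ hσ => (h.span σ hσ).mono hH, fun σ hσ hi => (h.image σ hσ hi).mono hH⟩

theorem isSymmForms_union {H H' : Finset (Module.Dual ℤ Λ)} [DecidableEq (Module.Dual ℤ Λ)]
    (h : IsSymmForms H) (h' : IsSymmForms H') : IsSymmForms (H ∪ H') := by
  intro k hk
  rcases Finset.mem_union.1 hk with hk | hk
  · exact Finset.mem_union_left _ (h k hk)
  · exact Finset.mem_union_right _ (h' k hk)

/-- The forms cut out the image of the span; if `f` is injective on it, they include extensions to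
the target of multiples of the inequalities that define `σ`. -/
theorem exists_forms_span_image [Module.Free ℤ Λ] [Module.Free ℤ Λ'] [Module.Finite ℤ Λ']
    (f : Λ →ₗ[ℤ] Λ') {σ : Set (VSpace Λ)} (hσ : IsCone σ) :
    ∃ S : Finset (Module.Dual ℤ Λ'), IsCellClosed S (realMap f '' coneSpan σ) ∧
      (Set.InjOn (realMap f) (coneSpan σ) → IsCellClosed S (realMap f '' σ)) := by
  classical
  obtain ⟨T, hT⟩ := exists_forms_baseChange ((coneLattice σ).map f)
  rw [← map_coneSpan_eq_baseChange hσ] at hT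
  have hspan : IsCellClosed (T ∪ T.image Neg.neg) (realMap f '' coneSpan σ) := by
    intro y hy z hz
    refine (hT z).2 fun h hh => ?_
    have h0 := (hT y).1 hy h hh
    have h1 := hz h (by simp [hh]) h0.ge
    have h2 := hz (-h) (by simp [hh]) (by simp [h0])
    rw [realForm_neg] at h2
    linarith
  by_cases hf : Set.InjOn (realMap f) (coneSpan σ)
  swap
  · exact ⟨_, hspan, fun h => absurd h hf⟩
  have hinj : ∀ l ∈ coneLattice σ, f l = 0 → l = 0 := by
    intro l hl h0
    refine eq_zero_of_latticeIncl_eq_zero (eq_zero_of_injOn hf hl ?_)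
    rw [realMap_latticeIncl, h0, map_zero]
  choose k N hN hk using exists_form_comp_eq_smul f (coneLattice σ) hinj
  have hk' : ∀ g, ∀ x ∈ coneSpan σ, realForm (k g) (realMap f x) = N g * realForm g x := by
    intro g
    have hle : coneSpan σ ≤
        LinearMap.ker (realForm (k g) ∘ₗ realMap f - (N g : ℝ) • realForm g) := by
      rw [← hσ.baseChange_coneLattice]
      refine baseChange_span_le fun l hl => ?_
      simp [hk g l hl]
    intro x hx
    have := hle hx
    simpa [sub_eq_zero] using this
  obtain ⟨F, G, rfl⟩ := hσ
  refine ⟨(T ∪ T.image Neg.neg) ∪ G.image k, hspan.mono Finset.subset_union_left, fun _ => ?_⟩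
  rintro _ ⟨x, hx, rfl⟩ z hz
  obtain ⟨x', hx', rfl⟩ := hspan _ ⟨x, Submodule.subset_span hx, rfl⟩
    (cell_anti Finset.subset_union_left hz)
  refine ⟨x', ⟨fun h hh => ?_, fun g hg => ?_⟩, rfl⟩
  · have hle : coneSpan (solutionSet F G) ≤ LinearMap.ker (realForm h) :=
      Submodule.span_le.2 fun y hy => hy.1 h hh
    exact hle hx'
  · have hNpos : (0 : ℝ) < N g := by exact_mod_cast hN g
    have h1 := hz (k g) (Finset.mem_union_right _ (Finset.mem_image_of_mem k hg)) (by
      rw [hk' g x (Submodule.subset_span hx)]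
      exact mul_nonneg hNpos.le (hx.2 g hg))
    rw [hk' g x' hx'] at h1
    exact nonneg_of_mul_nonneg_right h1 hNpos

theorem exists_isAdapted [Module.Free ℤ Λ] [Module.Free ℤ Λ'] [Module.Finite ℤ Λ']
    (X : Fan Λ) (f : Λ →ₗ[ℤ] Λ') : ∃ H, IsAdapted H X f := by
  classical
  choose S hS hS' using fun σ : X.cones => exists_forms_span_image f (X.isCone σ σ.2)
  let H := X.cones.attach.biUnion S
  have hsub : ∀ σ : X.cones, S σ ⊆ H ∪ H.image Neg.neg := fun σ =>
    (Finset.subset_biUnion_of_mem S (Finset.mem_attach _ σ)).trans Finset.subset_union_left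
  refine ⟨H ∪ H.image Neg.neg, fun h hh => ?_, fun σ hσ => (hS ⟨σ, hσ⟩).mono (hsub _),
    fun σ hσ hi => (hS' ⟨σ, hσ⟩ hi).mono (hsub _)⟩
  simp only [Finset.mem_union, Finset.mem_image] at hh ⊢
  rcases hh with hh | ⟨k, hk, rfl⟩
  · exact Or.inr ⟨h, hh, rfl⟩
  · exact Or.inl (by simpa using hk)

theorem finrank_map_coneSpan_le [Module.Finite ℤ Λ] (f : Λ →ₗ[ℤ] Λ') (σ : Set (VSpace Λ)) :
    Module.finrank ℝ ((coneSpan σ).map (realMap f)) ≤ coneDim σ :=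
  Submodule.finrank_map_le _ _

theorem injOn_of_coneDim_le [Module.Finite ℤ Λ] {f : Λ →ₗ[ℤ] Λ'} {σ : Set (VSpace Λ)}
    (h : coneDim σ ≤ Module.finrank ℝ ((coneSpan σ).map (realMap f))) :
    Set.InjOn (realMap f) (coneSpan σ) := by
  let φ := (realMap f).domRestrict (coneSpan σ)
  have h1 := LinearMap.finrank_range_add_finrank_ker φ
  have h2 : LinearMap.range φ = (coneSpan σ).map (realMap f) := by
    ext y; simp [φ]
  rw [h2] at h1
  have h3 : LinearMap.ker φ = ⊥ := by
    rw [← Submodule.finrank_eq_zero (R := ℝ)]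
    have : coneDim σ = Module.finrank ℝ (coneSpan σ) := rfl
    omega
  rw [Set.injOn_iff_injective]
  exact LinearMap.ker_eq_bot.1 h3

variable {H : Finset (Module.Dual ℤ Λ')} {X : Fan Λ} {f : Λ →ₗ[ℤ] Λ'} {σ : Set (VSpace Λ)}

theorem IsAdapted.coneSpan_cell_le (hH : IsAdapted H X f) (hσ : σ ∈ X.cones) {Q : VSpace Λ'}
    (hQ : Q ∈ realMap f '' coneSpan σ) : coneSpan (cell H Q) ≤ (coneSpan σ).map (realMap f) :=
  Submodule.span_le.2 (hH.span σ hσ Q hQ)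

/-- If the cell at a point of `f(σ)` has at least the dimension of `σ`, then `f` maps the span of
`σ` isomorphically onto the span of that cell. -/
theorem IsAdapted.injOn_and_map_eq [Module.Finite ℤ Λ] [Module.Finite ℤ Λ']
    (hH : IsAdapted H X f) (hσ : σ ∈ X.cones)
    {Q : VSpace Λ'} (hQ : Q ∈ realMap f '' σ) (hd : coneDim σ ≤ coneDim (cell H Q)) :
    Set.InjOn (realMap f) (coneSpan σ) ∧ coneSpan (cell H Q) = (coneSpan σ).map (realMap f) := by
  have hle := hH.coneSpan_cell_le hσ (Set.image_mono Submodule.subset_span hQ)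
  have h1 : coneDim (cell H Q) ≤ Module.finrank ℝ ((coneSpan σ).map (realMap f)) :=
    Submodule.finrank_mono hle
  refine ⟨injOn_of_coneDim_le (hd.trans h1), Submodule.eq_of_le_of_finrank_le hle ?_⟩
  exact (finrank_map_coneSpan_le f σ).trans hd

end Adapted

/-! ### Normal vectors and lattice indices -/

section Index

/-- The index of sublattices that differ by one further generator each. -/
theorem relIndex_sup_zmultiples {M : Type*} [AddCommGroup M] {A₀ B₀ : AddSubgroup M} {u w d : M}
    {m : ℕ} (hm : 0 < m) (hB : B₀ ≤ A₀) (hu : ∀ k : ℤ, k • u ∈ A₀ → k = 0) (hd : d ∈ A₀)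
    (hw : w = d + m • u) :
    (B₀ ⊔ AddSubgroup.zmultiples w).relIndex (A₀ ⊔ AddSubgroup.zmultiples u) =
      B₀.relIndex A₀ * m := by
  set B := B₀ ⊔ AddSubgroup.zmultiples w
  have hwB : w ∈ B := AddSubgroup.mem_sup_right (AddSubgroup.mem_zmultiples w)
  have huA : u ∈ A₀ ⊔ AddSubgroup.zmultiples u :=
    AddSubgroup.mem_sup_right (AddSubgroup.mem_zmultiples u)
  have hwu : ∀ k : ℤ, k • w ∈ A₀ → k = 0 := by
    intro k hk
    have h1 : (k * m) • u ∈ A₀ := by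
      have h2 : (k * m) • u = k • w - k • d := by rw [hw]; module
      rw [h2]
      exact sub_mem hk (zsmul_mem hd k)
    have := hu _ h1
    rcases mul_eq_zero.1 this with h | h
    · exact h
    · exact absurd (by exact_mod_cast h) hm.ne'
  have hBA : B ≤ A₀ ⊔ AddSubgroup.zmultiples u := by
    refine sup_le (hB.trans le_sup_left) ?_
    rw [AddSubgroup.zmultiples_le, hw]
    exact add_mem (AddSubgroup.mem_sup_left hd) (nsmul_mem huA m)
  have h1 : B.relIndex (A₀ ⊔ B) = B₀.relIndex A₀ := by
    rw [AddSubgroup.relIndex_sup_right, ← AddSubgroup.inf_relIndex_right]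
    congr 1
    refine le_antisymm ?_ (le_inf le_sup_left hB)
    rintro x ⟨hx, hxA⟩
    obtain ⟨b, hb, c, hc, rfl⟩ := AddSubgroup.mem_sup.1 hx
    obtain ⟨k, rfl⟩ := AddSubgroup.mem_zmultiples_iff.1 hc
    have hxA' : b + k • w ∈ A₀ := hxA
    have : k = 0 := hwu k (by simpa using A₀.sub_mem hxA' (hB hb))
    simpa [this] using hb
  have h2 : (A₀ ⊔ B).relIndex (AddSubgroup.zmultiples u ⊔ (A₀ ⊔ B)) = m := by
    rw [AddSubgroup.relIndex_sup_right]
    have h3 : AddSubgroup.zmultiples u = (⊤ : AddSubgroup ℤ).map (zmultiplesHom M u) := by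
      ext x; simp [AddSubgroup.mem_zmultiples_iff]
    rw [h3, ← AddSubgroup.relIndex_comap, AddSubgroup.relIndex_top_right]
    have h4 : (A₀ ⊔ B).comap (zmultiplesHom M u) = AddSubgroup.zmultiples (m : ℤ) := by
      ext k
      rw [AddSubgroup.mem_comap, zmultiplesHom_apply, Int.mem_zmultiples_iff]
      constructor
      · intro hk
        obtain ⟨a, ha, y, hy, h⟩ := AddSubgroup.mem_sup.1 hk
        obtain ⟨b, hb, c, hc, rfl⟩ := AddSubgroup.mem_sup.1 hy
        obtain ⟨j, rfl⟩ := AddSubgroup.mem_zmultiples_iff.1 hc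
        have : (k - j * m) • u ∈ A₀ := by
          have h5 : (k - j * m) • u = a + b + j • d := by
            rw [sub_smul, ← h, hw]; module
          rw [h5]
          exact add_mem (add_mem ha (hB hb)) (zsmul_mem hd j)
        exact ⟨j, by linarith [hu _ this]⟩
      · rintro ⟨j, rfl⟩
        have h5 : ((m : ℤ) * j) • u = (-j) • d + j • w := by rw [hw]; module
        rw [h5]
        exact add_mem (AddSubgroup.mem_sup_left (zsmul_mem hd _))
          (AddSubgroup.mem_sup_right (zsmul_mem hwB j))
    rw [h4, Int.index_zmultiples]; simp
  have h3 : AddSubgroup.zmultiples u ⊔ (A₀ ⊔ B) = A₀ ⊔ AddSubgroup.zmultiples u := by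
    refine le_antisymm (sup_le le_sup_right (sup_le le_sup_left hBA)) ?_
    exact sup_le (le_sup_left.trans le_sup_right) le_sup_left
  rw [h3] at h2
  rw [← h1, ← AddSubgroup.relIndex_mul_relIndex B (A₀ ⊔ B) _ le_sup_right
    (sup_le le_sup_left hBA), h2]

variable {Λ Λ' : Type*} [AddCommGroup Λ] [AddCommGroup Λ']

theorem map_coneLattice_le {f : Λ →ₗ[ℤ] Λ'} {σ : Set (VSpace Λ)} {C : Set (VSpace Λ')}
    (h : (coneSpan σ).map (realMap f) ≤ coneSpan C) : (coneLattice σ).map f ≤ coneLattice C := by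
  rintro _ ⟨l, hl, rfl⟩
  rw [mem_coneLattice, ← realMap_latticeIncl]
  exact h ⟨_, hl, rfl⟩

/-- Lattices that span the same real space have finite index in each other. -/
theorem latticeIndex_ne_zero [Module.Finite ℤ Λ'] {f : Λ →ₗ[ℤ] Λ'} {σ : Set (VSpace Λ)}
    {C : Set (VSpace Λ')} (hσ : IsCone σ) (h : (coneSpan σ).map (realMap f) = coneSpan C) :
    latticeIndex f σ C ≠ 0 := by
  let B := ((coneLattice σ).map f).comap (coneLattice C).subtype
  have htor : Module.IsTorsion ℤ (coneLattice C ⧸ B) := by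
    intro x
    obtain ⟨l, rfl⟩ := B.mkQ_surjective x
    have h1 : latticeIncl Λ' (l : Λ') ∈ ((coneLattice σ).map f).baseChange ℝ := by
      rw [← map_coneSpan_eq_baseChange hσ, h]
      exact l.2
    obtain ⟨N, hN, h2⟩ := exists_smul_mem_of_latticeIncl_mem h1
    refine ⟨⟨N, mem_nonZeroDivisors_of_ne_zero hN⟩, ?_⟩
    have h3 : N • l ∈ B := h2
    change N • B.mkQ l = 0
    rw [← map_smul]
    exact (Submodule.Quotient.mk_eq_zero B).2 h3
  have hfin : Finite (coneLattice C ⧸ B) := Module.finite_of_fg_torsion _ htor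
  have h3 : latticeIndex f σ C = Nat.card (coneLattice C ⧸ B) := rfl
  rw [h3]
  exact Nat.card_pos.ne'

variable {σ τ : Set (VSpace Λ)} {u : Λ}

theorem IsNormalVector.mem (h : IsNormalVector σ τ u) : u ∈ coneLattice σ := by
  rw [← h.1]
  exact Submodule.mem_sup_right (Submodule.mem_span_singleton_self u)

theorem IsNormalVector.eq_zero_of_smul_mem (h : IsNormalVector σ τ u) {a : ℝ}
    (ha : a • latticeIncl Λ u ∈ coneSpan τ) : a = 0 := by
  obtain ⟨-, g, hg0, -, hgu⟩ := h
  have hle : coneSpan τ ≤ LinearMap.ker (realForm g) := Submodule.span_le.2 hg0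
  have h1 : a * (g u : ℝ) = 0 := by simpa using hle ha
  have h2 : (g u : ℝ) ≠ 0 := by exact_mod_cast hgu.ne'
  exact (mul_eq_zero.1 h1).resolve_right h2

theorem IsNormalVector.eq_zero_of_zsmul_mem (h : IsNormalVector σ τ u) {k : ℤ}
    (hk : k • u ∈ coneLattice τ) : k = 0 := by
  rw [mem_coneLattice, map_zsmul, ← Int.cast_smul_eq_zsmul ℝ] at hk
  exact_mod_cast h.eq_zero_of_smul_mem hk

theorem IsNormalVector.exists_sub_mem (h : IsNormalVector σ τ u) {l : Λ} (hl : l ∈ coneLattice σ) :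
    ∃ k : ℤ, l - k • u ∈ coneLattice τ := by
  rw [← h.1] at hl
  obtain ⟨d, hd, c, hc, rfl⟩ := Submodule.mem_sup.1 hl
  obtain ⟨k, rfl⟩ := Submodule.mem_span_singleton.1 hc
  exact ⟨k, by simpa using hd⟩

/-- Modulo the span of the face, the points of a cone are nonnegative multiples of the normal
vector. -/
theorem IsNormalVector.exists_pos_smul (h : IsNormalVector σ τ u) (hσ : IsCone σ)
    {x : VSpace Λ} (hx : x ∈ σ) (hxτ : x ∉ coneSpan τ) :
    ∃ a : ℝ, 0 < a ∧ x - a • latticeIncl Λ u ∈ coneSpan τ := by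
  have hle : coneSpan σ ≤ coneSpan τ ⊔ Submodule.span ℝ {latticeIncl Λ u} := by
    rw [← hσ.baseChange_coneLattice]
    refine baseChange_span_le fun l hl => ?_
    obtain ⟨k, hk⟩ := h.exists_sub_mem hl
    have h1 : latticeIncl Λ l = latticeIncl Λ (l - k • u) + (k : ℝ) • latticeIncl Λ u := by
      rw [map_sub, map_zsmul, Int.cast_smul_eq_zsmul]; abel
    rw [h1]
    exact Submodule.add_mem_sup hk (Submodule.smul_mem _ _ (Submodule.mem_span_singleton_self _))
  obtain ⟨d, hd, c, hc, hdc⟩ := Submodule.mem_sup.1 (hle (Submodule.subset_span hx))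
  obtain ⟨a, rfl⟩ := Submodule.mem_span_singleton.1 hc
  refine ⟨a, lt_of_le_of_ne ?_ ?_, by rw [← hdc]; simpa using hd⟩
  · obtain ⟨-, g, hg0, hg, hgu⟩ := h
    have hle : coneSpan τ ≤ LinearMap.ker (realForm g) := Submodule.span_le.2 hg0
    have h1 := hg x hx
    have h2 : realForm g d = 0 := hle hd
    rw [← hdc, map_add, h2, map_smul, realForm_latticeIncl, zero_add, smul_eq_mul] at h1
    have h3 : (0 : ℝ) < g u := by exact_mod_cast hgu
    exact nonneg_of_mul_nonneg_left h1 h3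
  · rintro rfl
    apply hxτ
    rw [← hdc]
    simpa using hd

/-- A supporting form of the facet `τ` embeds `Λ_σ / Λ_τ` in `ℤ`; a generator of its image lifts to
a normal vector. -/
theorem exists_isNormalVector [Module.Finite ℤ Λ] (hτ : IsFace τ σ)
    (hd : coneDim τ + 1 = coneDim σ) : ∃ u, IsNormalVector σ τ u := by
  obtain ⟨hσ, g, hg, hτg⟩ := isFace_iff.1 hτ
  have hg0 : ∀ x ∈ τ, realForm g x = 0 := fun x hx => by rw [hτg] at hx; exact hx.2
  have hle : coneSpan τ ≤ coneSpan σ ⊓ LinearMap.ker (realForm g) :=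
    le_inf (coneSpan_mono hτ.subset) (Submodule.span_le.2 hg0)
  have hne : ¬ coneSpan σ ≤ LinearMap.ker (realForm g) := by
    intro hall
    have : τ = σ := by
      rw [hτg]
      exact Set.Subset.antisymm (Set.sep_subset _ _)
        fun x hx => ⟨hx, hall (Submodule.subset_span hx)⟩
    rw [this] at hd
    omega
  have heq : coneSpan τ = coneSpan σ ⊓ LinearMap.ker (realForm g) := by
    refine Submodule.eq_of_le_of_finrank_le hle ?_
    have h1 : coneSpan σ ⊓ LinearMap.ker (realForm g) < coneSpan σ :=
      lt_of_le_of_ne inf_le_left fun h => hne (inf_eq_left.1 h)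
    have h2 := Submodule.finrank_lt_finrank_of_lt h1
    have h3 : coneDim σ = Module.finrank ℝ (coneSpan σ) := rfl
    have h4 : coneDim τ = Module.finrank ℝ (coneSpan τ) := rfl
    omega
  obtain ⟨m, hm⟩ := (IsPrincipalIdealRing.principal ((coneLattice σ).map g)).principal
  have hlat : ∀ l ∈ coneLattice σ, g l = 0 → l ∈ coneLattice τ := by
    intro l hl h0
    rw [mem_coneLattice, heq]
    exact ⟨hl, by simp [h0]⟩
  -- the sign of the generator is chosen so that the normal vector lies on the side of `σ`
  obtain ⟨m', hm'0, hm'⟩ : ∃ m' : ℤ, 0 ≤ m' ∧ (coneLattice σ).map g = Submodule.span ℤ {m'} := by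
    refine ⟨|m|, abs_nonneg m, ?_⟩
    rw [hm]
    rcases abs_choice m with h | h <;> rw [h]
    rw [← Set.neg_singleton, Submodule.span_neg]
  have hpos : 0 < m' := by
    refine lt_of_le_of_ne hm'0 ?_
    rintro rfl
    apply hne
    rw [← hσ.baseChange_coneLattice]
    refine baseChange_span_le fun l hl => ?_
    have h1 : g l ∈ (coneLattice σ).map g := ⟨l, hl, rfl⟩
    rw [hm'] at h1
    simp at h1
    simp [h1]
  have hmem : m' ∈ (coneLattice σ).map g := by
    rw [hm']; exact Submodule.mem_span_singleton_self m'
  obtain ⟨u, hu, hgu⟩ := hmem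
  refine ⟨u, le_antisymm (sup_le (coneLattice_mono hτ.subset) ?_) fun l hl => ?_, g, hg0, hg, ?_⟩
  · rw [Submodule.span_singleton_le_iff_mem]; exact hu
  · have h1 : g l ∈ (coneLattice σ).map g := ⟨l, hl, rfl⟩
    rw [hm'] at h1
    obtain ⟨k, hk⟩ := Submodule.mem_span_singleton.1 h1
    have h2 : l - k • u ∈ coneLattice τ := by
      refine hlat _ (sub_mem hl (Submodule.smul_mem _ _ hu)) ?_
      rw [map_sub, map_smul, hgu, hk, sub_self]
    have h3 : l = (l - k • u) + k • u := by abel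
    rw [h3]
    exact Submodule.add_mem_sup h2 (Submodule.smul_mem _ _ (Submodule.mem_span_singleton_self u))
  · rw [hgu]; exact hpos

/-- If `f` maps `σ` and its facet `τ` to cones `C` and `D` and the normal vector of `σ` to `m` times
that of `C`, then the lattice index of `f` on `σ` is `m` times that on `τ`. -/
theorem latticeIndex_eq_mul {f : Λ →ₗ[ℤ] Λ'} {C D : Set (VSpace Λ')} {w : Λ'}
    (hu : IsNormalVector σ τ u) (hw : IsNormalVector C D w)
    (hle : (coneSpan τ).map (realMap f) ≤ coneSpan D) {m : ℕ} (hm : 0 < m)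
    (hd : f u - m • w ∈ coneLattice D) :
    latticeIndex f σ C = latticeIndex f τ D * m := by
  have h1 := relIndex_sup_zmultiples (A₀ := (coneLattice D).toAddSubgroup)
    (B₀ := ((coneLattice τ).map f).toAddSubgroup) (u := w) (w := f u) hm
    (map_coneLattice_le hle) (fun k hk => hw.eq_zero_of_zsmul_mem hk) hd (by abel)
  have h2 : (coneLattice D).toAddSubgroup ⊔ AddSubgroup.zmultiples w =
      (coneLattice C).toAddSubgroup := by
    rw [← hw.1, Submodule.sup_toAddSubgroup, Submodule.span_singleton_toAddSubgroup_eq_zmultiples]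
  have h3 : ((coneLattice τ).map f).toAddSubgroup ⊔ AddSubgroup.zmultiples (f u) =
      ((coneLattice σ).map f).toAddSubgroup := by
    rw [← hu.1, Submodule.map_sup, Submodule.sup_toAddSubgroup, Submodule.map_span,
      Set.image_singleton, Submodule.span_singleton_toAddSubgroup_eq_zmultiples]
  rw [h2, h3] at h1
  exact h1

end Index

/-! ### The cells around a cell of codimension one -/

section Local

variable {Λ Λ' : Type*} [AddCommGroup Λ] [AddCommGroup Λ']

/-- A cell containing `Q` depends only on the ray, modulo the span of the cell of `Q`, in which
its interior points lie. -/
theorem cell_eq_of_sub_smul_mem {H : Finset (Module.Dual ℤ Λ)} (hH : IsSymmForms H)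
    {Q p p' : VSpace Λ} (hQ : Q ∈ cell H p) (hQ' : Q ∈ cell H p') {a : ℝ} (ha : 0 < a)
    (h : p' - a • p ∈ coneSpan (cell H Q)) : cell H p = cell H p' := by
  have aux : ∀ (p p' : VSpace Λ) (a : ℝ), Q ∈ cell H p → Q ∈ cell H p' → 0 < a →
      p' - a • p ∈ coneSpan (cell H Q) → cell H p ⊆ cell H p' := by
    intro p p' a hQ hQ' ha h x hx k hk hk0
    refine hx k hk ?_
    by_contra! hneg
    have h1 := realForm_nonpos_of_mem_cell hH hQ hk hneg.le
    have h2 := hQ' k hk hk0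
    have h3 := (mem_coneSpan_cell hH).1 h k hk (le_antisymm h1 h2)
    rw [map_sub, map_smul, smul_eq_mul] at h3
    nlinarith
  refine Set.Subset.antisymm (aux p p' a hQ hQ' ha h) (aux p' p a⁻¹ hQ' hQ (inv_pos.2 ha) ?_)
  have h1 : p - a⁻¹ • p' = (-a⁻¹) • (p' - a • p) := by
    rw [smul_sub, smul_smul, neg_mul, inv_mul_cancel₀ ha.ne']; module
  rw [h1]
  exact Submodule.smul_mem _ _ h

theorem coneSpan_cell_le {H : Finset (Module.Dual ℤ Λ)} (hH : IsSymmForms H)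
    {Q p : VSpace Λ} (hp : p ∈ coneSpan (cell H Q)) :
    coneSpan (cell H p) ≤ coneSpan (cell H Q) := by
  intro x hx
  rw [mem_coneSpan_cell hH] at hx hp ⊢
  exact fun h hh h0 => hx h hh (hp h hh h0)

open Filter Topology in
theorem eventually_mem_cell_add_smul (H : Finset (Module.Dual ℤ Λ)) (Q v : VSpace Λ) :
    ∀ᶠ δ in 𝓝[>] (0 : ℝ), Q ∈ cell H (Q + δ • v) := by
  filter_upwards [eventually_strict_signs H Q v] with δ hδ h hh h0
  by_contra! hneg
  exact absurd ((hδ h hh).2 hneg) (not_lt.2 h0)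

open Filter Topology in
theorem IsCone.eventually_add_smul_mem {σ : Set (VSpace Λ)} (hσ : IsCone σ) {P v : VSpace Λ}
    (hP : P ∈ coneInterior σ) (hv : v ∈ coneSpan σ) :
    ∀ᶠ δ in 𝓝[>] (0 : ℝ), P + δ • v ∈ σ := by
  obtain ⟨ε, hε, hmem⟩ := hP.2 v hv
  filter_upwards [Ioo_mem_nhdsGT hε] with δ hδ
  have h1 : P + δ • v = (1 - δ / ε) • P + (δ / ε) • (P + ε • v) := by
    rw [smul_add, smul_smul, div_mul_cancel₀ _ hε.ne']; module
  rw [h1]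
  refine hσ.add_mem (hσ.smul_mem hP.1 ?_) (hσ.smul_mem hmem (div_pos hδ.1 hε).le)
  rw [sub_nonneg, div_le_one hε]
  exact hδ.2.le

theorem notMem_coneSpan_of_coneDim [Module.Finite ℤ Λ] {H : Finset (Module.Dual ℤ Λ)}
    {Q p : VSpace Λ} (hH : IsSymmForms H)
    (hd : coneDim (cell H Q) + 1 = coneDim (cell H p)) : p ∉ coneSpan (cell H Q) := by
  intro hp
  have h1 : coneDim (cell H p) ≤ coneDim (cell H Q) :=
    Submodule.finrank_mono (coneSpan_cell_le hH hp)
  omega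

theorem finrank_map_coneSpan_of_injOn {f : Λ →ₗ[ℤ] Λ'} {σ : Set (VSpace Λ)}
    (hf : Set.InjOn (realMap f) (coneSpan σ)) :
    Module.finrank ℝ ((coneSpan σ).map (realMap f)) = coneDim σ := by
  have h1 := LinearMap.finrank_range_of_inj
    (f := (realMap f).domRestrict (coneSpan σ)) (Set.injOn_iff_injective.1 hf)
  rwa [LinearMap.range_domRestrict] at h1

variable [Module.Finite ℤ Λ] [Module.Finite ℤ Λ']
  {H : Finset (Module.Dual ℤ Λ')} {X : Fan Λ} {f : Λ →ₗ[ℤ] Λ'} {σ τ : Set (VSpace Λ)}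
  {Q : VSpace Λ'}

/-- The cells in `f(σ)` next to a cell of codimension one. -/
theorem IsAdapted.coneDim_and_coneSpan_cell (hH : IsAdapted H X f) (hσ : σ ∈ X.cones)
    (hd : coneDim (cell H Q) + 1 = coneDim σ) {p : VSpace Λ'} (hp : p ∈ realMap f '' σ)
    (hQ : Q ∈ cell H p) (hpQ : p ∉ coneSpan (cell H Q)) :
    coneDim (cell H p) = coneDim σ ∧ coneSpan (cell H p) = (coneSpan σ).map (realMap f) := by
  have hlt : coneSpan (cell H Q) < coneSpan (cell H p) := by
    refine lt_of_le_of_ne (coneSpan_mono (cell_subset_of_mem hQ)) fun h => hpQ ?_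
    rw [h]
    exact Submodule.subset_span self_mem_cell
  have h1 : coneDim (cell H Q) < coneDim (cell H p) := Submodule.finrank_lt_finrank_of_lt hlt
  have h2 := (hH.injOn_and_map_eq hσ hp (by omega)).2
  refine ⟨le_antisymm ?_ (by omega), h2⟩
  have h3 : coneDim (cell H p) = Module.finrank ℝ (coneSpan (cell H p)) := rfl
  rw [h3, h2]
  exact finrank_map_coneSpan_le f σ

/-- If `Q` has a preimage on a facet `τ` of `σ`, exactly one of the cells around the cell of `Q`
lies in `f(σ)`. Its lattice index times its normal vector is the lattice index of `τ` times the
image of the normal vector of `σ`, modulo the span of the cell of `Q`. -/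
theorem IsAdapted.sum_cells_of_mem_facet (hH : IsAdapted H X f) (hσ : σ ∈ X.cones)
    (hinj : Set.InjOn (realMap f) (coneSpan σ)) (hτ : τ ∈ X.cones) (hτσ : IsFace τ σ)
    (hdτ : coneDim τ + 1 = coneDim σ) (hdQ : coneDim (cell H Q) + 1 = coneDim σ)
    (hQ : Q ∈ realMap f '' τ) {v : Λ} (hv : IsNormalVector σ τ v)
    (T : Finset (Set (VSpace Λ'))) (u : Set (VSpace Λ') → Λ')
    (hT : ∀ C ∈ T, (∃ p, C = cell H p) ∧ Q ∈ C ∧ coneDim C = coneDim σ ∧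
      IsNormalVector C (cell H Q) (u C))
    (hT' : ∀ p ∈ realMap f '' σ, Q ∈ cell H p → coneDim (cell H p) = coneDim σ → cell H p ∈ T) :
    open Classical in
    ∑ C ∈ T with C ⊆ realMap f '' σ,
        latticeIndex f σ C • (coneSpan (cell H Q)).mkQ (latticeIncl Λ' (u C)) =
      latticeIndex f τ (cell H Q) • (coneSpan (cell H Q)).mkQ (latticeIncl Λ' (f v)) := by
  classical
  have hσc := X.isCone σ hσ
  set D := cell H Q with hD
  have hDτ : coneSpan D = (coneSpan τ).map (realMap f) :=
    (hH.injOn_and_map_eq hτ hQ (by rw [← hD]; omega)).2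
  have hfτ : ∀ x ∈ coneSpan σ, realMap f x ∈ coneSpan D → x ∈ coneSpan τ := by
    intro x hx hfx
    rw [hDτ] at hfx
    obtain ⟨y, hy, hxy⟩ := hfx
    rwa [← hinj (coneSpan_mono hτσ.subset hy) hx hxy]
  obtain ⟨s, hs⟩ := hσc.exists_mem_coneInterior
  have hsτ : s ∉ coneSpan τ := by
    intro h
    have h1 : s ∈ τ := by rw [hτσ.eq_inter_coneSpan]; exact ⟨hs.1, h⟩
    rw [hτσ.eq_of_mem_coneInterior h1 hs] at hdτ
    omega
  obtain ⟨a, ha, hsa⟩ := hv.exists_pos_smul hσc hs.1 hsτ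
  obtain ⟨P, hP, rfl⟩ := hQ
  set Q := realMap f P with hQdef
  -- a point of `f(σ)` close to `Q` and off the span of `D`
  obtain ⟨δ, hδ, hδ0⟩ := ((eventually_mem_cell_add_smul H Q (realMap f s)).and
    self_mem_nhdsWithin).exists
  replace hδ0 : 0 < δ := hδ0
  set p := Q + δ • realMap f s with hp
  have hPs : P + δ • s ∈ σ := hσc.add_mem (hτσ.subset hP) (hσc.smul_mem hs.1 hδ0.le)
  have hpσ : p ∈ realMap f '' σ := ⟨_, hPs, by rw [map_add, map_smul]⟩
  have hQD : Q ∈ coneSpan D := Submodule.subset_span self_mem_cell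
  have hpD : p ∉ coneSpan D := by
    intro h
    rw [hp, Submodule.add_mem_iff_right _ hQD, Submodule.smul_mem_iff _ hδ0.ne'] at h
    exact hsτ (hfτ s (Submodule.subset_span hs.1) h)
  obtain ⟨hdp, hsp⟩ := hH.coneDim_and_coneSpan_cell hσ hdQ hpσ hδ hpD
  have hpT : cell H p ∈ T := hT' p hpσ hδ hdp
  have hu := (hT _ hpT).2.2.2
  have hfD : ∀ {x}, x ∈ coneSpan τ → realMap f x ∈ coneSpan D := fun hx => by
    rw [hDτ]; exact ⟨_, hx, rfl⟩
  have hfilter : T.filter (fun C => C ⊆ realMap f '' σ) = {cell H p} := by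
    ext C
    rw [Finset.mem_filter, Finset.mem_singleton]
    constructor
    · rintro ⟨hC, hCσ⟩
      obtain ⟨⟨p', rfl⟩, hQC, hdC, -⟩ := hT C hC
      obtain ⟨x', hx', hfx'⟩ := hCσ self_mem_cell
      have hx'τ : x' ∉ coneSpan τ := by
        intro h
        refine notMem_coneSpan_of_coneDim hH.symm (hdQ.trans hdC.symm) ?_
        rw [← hfx']
        exact hfD h
      obtain ⟨a', ha', hsa'⟩ := hv.exists_pos_smul hσc hx' hx'τ
      refine cell_eq_of_sub_smul_mem hH.symm hQC hδ (a := δ * (a / a')) (by positivity) ?_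
      have h1 : p - (δ * (a / a')) • p' = Q + δ • realMap f (s - a • latticeIncl Λ v)
          - (δ * (a / a')) • realMap f (x' - a' • latticeIncl Λ v) := by
        have h2 : δ * (a / a') * a' = δ * a := by field_simp
        rw [hp, ← hfx', map_sub, map_sub, map_smul, map_smul, smul_sub, smul_sub, smul_smul,
          smul_smul, h2]
        abel
      rw [h1]
      exact sub_mem (add_mem hQD (Submodule.smul_mem _ _ (hfD hsa)))
        (Submodule.smul_mem _ _ (hfD hsa'))
    · rintro rfl
      exact ⟨hpT, hH.image σ hσ hinj p hpσ⟩
  rw [hfilter, Finset.sum_singleton]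
  have hfv : f v ∈ coneLattice (cell H p) :=
    map_coneLattice_le hsp.ge ⟨v, hv.mem, rfl⟩
  obtain ⟨m, hm⟩ := hu.exists_sub_mem hfv
  -- the multiple is positive because `p` lies on the side of the normal vectors
  have hmpos : 0 < m := by
    obtain ⟨b, hb, hpb⟩ := hu.exists_pos_smul isCone_cell self_mem_cell hpD
    have h1 : ((m : ℝ) * (δ * a) - b) • latticeIncl Λ' (u (cell H p)) ∈ coneSpan D := by
      have h2 : ((m : ℝ) * (δ * a) - b) • latticeIncl Λ' (u (cell H p)) =
          (p - b • latticeIncl Λ' (u (cell H p))) - Q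
          - δ • realMap f (s - a • latticeIncl Λ v)
          - (δ * a) • latticeIncl Λ' (f v - m • u (cell H p)) := by
        rw [hp, map_sub (realMap f), map_smul, realMap_latticeIncl, map_sub (latticeIncl Λ'),
          map_zsmul, ← Int.cast_smul_eq_zsmul ℝ]
        module
      rw [h2]
      exact sub_mem (sub_mem (sub_mem hpb hQD) (Submodule.smul_mem _ _ (hfD hsa)))
        (Submodule.smul_mem _ _ hm)
    have h3 := hu.eq_zero_of_smul_mem h1
    have h4 : 0 < (m : ℝ) * (δ * a) := by linarith
    exact_mod_cast (pos_iff_pos_of_mul_pos h4).2 (by positivity)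
  lift m to ℕ using hmpos.le
  rw [natCast_zsmul] at hm
  rw [latticeIndex_eq_mul hv hu hDτ.ge (by exact_mod_cast hmpos) hm, mul_smul]
  congr 1
  rw [← map_nsmul, ← map_nsmul, eq_comm, ← sub_eq_zero, ← map_sub, ← map_sub]
  exact (Submodule.Quotient.mk_eq_zero _).2 hm

/-- If `Q` has a preimage in the interior of `σ`, exactly two of the cells around the cell of `Q`
lie in `f(σ)`, and their contributions cancel. -/
theorem IsAdapted.sum_cells_of_mem_coneInterior (hH : IsAdapted H X f) (hσ : σ ∈ X.cones)
    (hinj : Set.InjOn (realMap f) (coneSpan σ))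
    (hdQ : coneDim (cell H Q) + 1 = coneDim σ)
    (hQ : Q ∈ realMap f '' coneInterior σ)
    (T : Finset (Set (VSpace Λ'))) (u : Set (VSpace Λ') → Λ')
    (hT : ∀ C ∈ T, (∃ p, C = cell H p) ∧ Q ∈ C ∧ coneDim C = coneDim σ ∧
      IsNormalVector C (cell H Q) (u C))
    (hT' : ∀ p ∈ realMap f '' σ, Q ∈ cell H p → coneDim (cell H p) = coneDim σ → cell H p ∈ T) :
    open Classical in
    ∑ C ∈ T with C ⊆ realMap f '' σ,
        latticeIndex f σ C • (coneSpan (cell H Q)).mkQ (latticeIncl Λ' (u C)) = 0 := by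
  classical
  have hσc := X.isCone σ hσ
  obtain ⟨P, hP, rfl⟩ := hQ
  set Q := realMap f P with hQdef
  set D := cell H Q with hD
  have hQD : Q ∈ coneSpan D := Submodule.subset_span self_mem_cell
  have hQσ : Q ∈ realMap f '' σ := ⟨P, hP.1, rfl⟩
  have hDle : coneSpan D ≤ (coneSpan σ).map (realMap f) :=
    hH.coneSpan_cell_le hσ (Set.image_mono Submodule.subset_span hQσ)
  have hfin : Module.finrank ℝ ((coneSpan σ).map (realMap f)) = coneDim σ :=
    finrank_map_coneSpan_of_injOn hinj
  obtain ⟨y, ⟨v, hv, rfl⟩, hvD⟩ : ∃ y ∈ (coneSpan σ).map (realMap f), y ∉ coneSpan D := by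
    by_contra! hall
    have h1 : coneDim D = Module.finrank ℝ (coneSpan D) := rfl
    have h2 := Submodule.finrank_mono (show (coneSpan σ).map (realMap f) ≤ coneSpan D from hall)
    omega
  set y := realMap f v with hy
  -- modulo the span of `D`, the span of `f(σ)` is the line through `y`
  have hline : (coneSpan σ).map (realMap f) ≤ coneSpan D ⊔ Submodule.span ℝ {y} := by
    refine (Submodule.eq_of_le_of_finrank_le (sup_le hDle ?_) ?_).ge
    · rw [Submodule.span_singleton_le_iff_mem]; exact ⟨v, hv, rfl⟩
    · have hlt : coneSpan D < coneSpan D ⊔ Submodule.span ℝ {y} := by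
        refine lt_of_le_of_ne le_sup_left fun h => hvD ?_
        rw [h]
        exact Submodule.mem_sup_right (Submodule.mem_span_singleton_self y)
      have h1 := Submodule.finrank_lt_finrank_of_lt hlt
      rw [hfin]
      have h2 : coneDim D = Module.finrank ℝ (coneSpan D) := rfl
      omega
  obtain ⟨δ, ⟨⟨hQ₁, hQ₂⟩, hP₁, hP₂⟩, hδ0⟩ := (((eventually_mem_cell_add_smul H Q y).and
    (eventually_mem_cell_add_smul H Q (-y))).and ((hσc.eventually_add_smul_mem hP hv).and
    (hσc.eventually_add_smul_mem hP (neg_mem hv)))).and self_mem_nhdsWithin |>.exists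
  replace hδ0 : 0 < δ := hδ0
  set p₁ := Q + δ • y with hp₁
  set p₂ := Q + δ • (-y) with hp₂
  have hp₁σ : p₁ ∈ realMap f '' σ := ⟨_, hP₁, by rw [map_add, map_smul]⟩
  have hp₂σ : p₂ ∈ realMap f '' σ := ⟨_, hP₂, by rw [map_add, map_smul, map_neg]⟩
  have hp₁D : p₁ ∉ coneSpan D := by
    rwa [hp₁, Submodule.add_mem_iff_right _ hQD, Submodule.smul_mem_iff _ hδ0.ne']
  have hp₂D : p₂ ∉ coneSpan D := by
    rwa [hp₂, Submodule.add_mem_iff_right _ hQD, Submodule.smul_mem_iff _ hδ0.ne', neg_mem_iff]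
  obtain ⟨hd₁, hs₁⟩ := hH.coneDim_and_coneSpan_cell hσ hdQ hp₁σ hQ₁ hp₁D
  obtain ⟨hd₂, hs₂⟩ := hH.coneDim_and_coneSpan_cell hσ hdQ hp₂σ hQ₂ hp₂D
  have hT₁ := hT' p₁ hp₁σ hQ₁ hd₁
  have hT₂ := hT' p₂ hp₂σ hQ₂ hd₂
  have hu₁ := (hT _ hT₁).2.2.2
  have hu₂ := (hT _ hT₂).2.2.2
  obtain ⟨a, ha, hpa⟩ := hu₁.exists_pos_smul isCone_cell self_mem_cell hp₁D
  obtain ⟨b, hb, hpb⟩ := hu₂.exists_pos_smul isCone_cell self_mem_cell hp₂D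
  set w₁ := u (cell H p₁) with hw₁
  set w₂ := u (cell H p₂) with hw₂
  have hab : a • latticeIncl Λ' w₁ + b • latticeIncl Λ' w₂ ∈ coneSpan D := by
    have h1 : a • latticeIncl Λ' w₁ + b • latticeIncl Λ' w₂ = (2 : ℝ) • Q
        - (p₁ - a • latticeIncl Λ' w₁) - (p₂ - b • latticeIncl Λ' w₂) := by
      rw [hp₁, hp₂]; module
    rw [h1]
    exact sub_mem (sub_mem (Submodule.smul_mem _ _ hQD) hpa) hpb
  have hne : cell H p₁ ≠ cell H p₂ := by
    intro h
    rw [hw₂, ← h, ← hw₁, ← add_smul] at hab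
    have := hu₁.eq_zero_of_smul_mem hab
    linarith
  have hlat : coneLattice (cell H p₁) = coneLattice (cell H p₂) := by
    rw [coneLattice, coneLattice, hs₁, hs₂]
  have hfilter : T.filter (fun C => C ⊆ realMap f '' σ) = {cell H p₁, cell H p₂} := by
    ext C
    rw [Finset.mem_filter, Finset.mem_insert, Finset.mem_singleton]
    constructor
    · rintro ⟨hC, hCσ⟩
      obtain ⟨⟨p', rfl⟩, hQC, hdC, -⟩ := hT C hC
      have hp'D := notMem_coneSpan_of_coneDim hH.symm (hdQ.trans hdC.symm)
      obtain ⟨x', hx', hfx'⟩ := hCσ self_mem_cell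
      obtain ⟨d, hd, c, hc, hdc⟩ :=
        Submodule.mem_sup.1 (hline ⟨x', Submodule.subset_span hx', hfx'⟩)
      obtain ⟨t, rfl⟩ := Submodule.mem_span_singleton.1 hc
      rcases lt_trichotomy t 0 with ht | rfl | ht
      · right
        refine (cell_eq_of_sub_smul_mem hH.symm hQ₂ hQC (a := -t / δ)
          (div_pos (by linarith) hδ0) ?_).symm
        have h1 : p' - (-t / δ) • p₂ = d - (-t / δ) • Q := by
          rw [hp₂, ← hdc, smul_add, smul_smul, div_mul_cancel₀ _ hδ0.ne']; module
        rw [h1]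
        exact sub_mem hd (Submodule.smul_mem _ _ hQD)
      · exact absurd (by rw [← hdc]; simpa using hd) hp'D
      · left
        refine (cell_eq_of_sub_smul_mem hH.symm hQ₁ hQC (a := t / δ) (div_pos ht hδ0) ?_).symm
        have h1 : p' - (t / δ) • p₁ = d - (t / δ) • Q := by
          rw [hp₁, ← hdc, smul_add, smul_smul, div_mul_cancel₀ _ hδ0.ne']; module
        rw [h1]
        exact sub_mem hd (Submodule.smul_mem _ _ hQD)
    · rintro (rfl | rfl)
      · exact ⟨hT₁, hH.image σ hσ hinj p₁ hp₁σ⟩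
      · exact ⟨hT₂, hH.image σ hσ hinj p₂ hp₂σ⟩
  have hind : latticeIndex f σ (cell H p₂) = latticeIndex f σ (cell H p₁) := by
    rw [latticeIndex, latticeIndex, hlat]
  rw [hfilter, Finset.sum_pair hne, hind, ← smul_add, ← map_add, ← map_add]
  -- both normal vectors generate the same group modulo `D`, hence they agree up to sign
  obtain ⟨k, hk⟩ := hu₁.exists_sub_mem (l := w₂) (by rw [hlat]; exact hu₂.mem)
  obtain ⟨k', hk'⟩ := hu₂.exists_sub_mem (l := w₁) (by rw [← hlat]; exact hu₁.mem)
  have hkk : k' * k = 1 := by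
    have h1 : (1 - k' * k) • w₁ ∈ coneLattice D := by
      have h2 : (1 - k' * k) • w₁ = (w₁ - k' • w₂) + k' • (w₂ - k • w₁) := by module
      rw [h2]
      exact add_mem hk' (Submodule.smul_mem _ _ hk)
    linarith [hu₁.eq_zero_of_zsmul_mem h1]
  have hkneg : (k : ℝ) < 0 := by
    have h1 : (a + b * k) • latticeIncl Λ' w₁ ∈ coneSpan D := by
      have h2 : (a + b * k) • latticeIncl Λ' w₁ = (a • latticeIncl Λ' w₁ + b • latticeIncl Λ' w₂)
          - b • latticeIncl Λ' (w₂ - k • w₁) := by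
        rw [map_sub, map_zsmul, ← Int.cast_smul_eq_zsmul ℝ]; module
      rw [h2]
      exact sub_mem hab (Submodule.smul_mem _ _ hk)
    have h3 := hu₁.eq_zero_of_smul_mem h1
    by_contra! h4
    have := mul_nonneg hb.le h4
    linarith
  have hkm : k = -1 := by
    rcases Int.eq_one_or_neg_one_of_mul_eq_one (by rw [mul_comm] at hkk; exact hkk) with h | h
    · rw [h] at hkneg; norm_num at hkneg
    · exact h
  have h5 : w₁ + w₂ ∈ coneLattice D := by
    have h6 : w₁ + w₂ = w₂ - k • w₁ := by rw [hkm]; module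
    rw [h6]; exact hk
  have h7 : (coneSpan D).mkQ (latticeIncl Λ' (w₁ + w₂)) = 0 :=
    (Submodule.Quotient.mk_eq_zero _).2 h5
  rw [h7, smul_zero]

end Local

/-! ### The push-forward is balanced -/

section PushForward

variable {Λ Λ' : Type*} [AddCommGroup Λ] [AddCommGroup Λ'] {n : ℕ}

theorem WeightedFan.coneDim_le (X : WeightedFan Λ n) {σ : Set (VSpace Λ)} (hσ : σ ∈ X.cones) :
    coneDim σ ≤ n := by
  have h1 : (coneDim σ : WithBot ℕ) ≤ X.toFan.dim :=
    Finset.le_sup (f := fun σ : Set (VSpace Λ) => (coneDim σ : WithBot ℕ)) hσ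
  rw [X.dim_eq] at h1
  exact_mod_cast h1

/-- The weight of a cell `C` in the push-forward of `X` along `f`: the number of top-dimensional
cones of `X` whose image contains `C`, counted with weight and lattice index. -/
noncomputable def pushWeight (X : WeightedFan Λ n) (f : Λ →ₗ[ℤ] Λ') (C : Set (VSpace Λ')) : ℕ :=
  open Classical in
  ∑ σ ∈ X.cones with coneDim σ = n ∧ C ⊆ realMap f '' σ, X.weight σ * latticeIndex f σ C

variable [Module.Finite ℤ Λ] [Module.Finite ℤ Λ']
  {H : Finset (Module.Dual ℤ Λ')} {f : Λ →ₗ[ℤ] Λ'} {Q : VSpace Λ'}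

/-- The contribution of a cone `σ` to the balancing condition at the cell of `Q` is carried by the
facets of `σ` whose image contains `Q`. For `f` injective on the span of `σ` there is no such facet if
`Q` has a preimage in the interior of `σ`, and exactly one if it has a preimage on the boundary. -/
theorem IsAdapted.sum_cells_eq_sum_facets {X : Fan Λ} (hH : IsAdapted H X f)
    (hdQ : coneDim (cell H Q) + 1 = n) {σ : Set (VSpace Λ)} (hσ : σ ∈ X.cones)
    (hdσ : coneDim σ = n) (T : Finset (Set (VSpace Λ'))) (u : Set (VSpace Λ') → Λ')
    (hT : ∀ C ∈ T, (∃ p, C = cell H p) ∧ Q ∈ C ∧ coneDim C = n ∧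
      IsNormalVector C (cell H Q) (u C))
    (hT' : ∀ p ∈ realMap f '' σ, Q ∈ cell H p → coneDim (cell H p) = n → cell H p ∈ T)
    (v : Set (VSpace Λ) → Λ)
    (hv : ∀ τ ∈ X.cones, coneDim τ + 1 = n → IsFace τ σ → IsNormalVector σ τ (v τ)) :
    open Classical in
    ∑ C ∈ T with C ⊆ realMap f '' σ,
        latticeIndex f σ C • (coneSpan (cell H Q)).mkQ (latticeIncl Λ' (u C)) =
      ∑ τ ∈ X.cones with (coneDim τ + 1 = n ∧ Q ∈ realMap f '' τ) ∧ IsFace τ σ,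
        latticeIndex f τ (cell H Q) •
          (coneSpan (cell H Q)).mkQ (latticeIncl Λ' (f (v τ))) := by
  classical
  subst hdσ
  have hσc := X.isCone σ hσ
  by_cases hQσ : Q ∈ realMap f '' σ
  swap
  · rw [Finset.filter_false_of_mem fun C hC h => hQσ (h (hT C hC).2.1), Finset.sum_empty,
      Finset.filter_false_of_mem fun τ _ h => hQσ (Set.image_mono h.2.subset h.1.2),
      Finset.sum_empty]
  by_cases hinj : Set.InjOn (realMap f) (coneSpan σ)
  swap
  · -- the image of `σ` has too small a dimension
    have h0 : T.filter (fun C => C ⊆ realMap f '' σ) = ∅ := by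
      refine Finset.filter_false_of_mem fun C hC h => hinj ?_
      obtain ⟨⟨p, rfl⟩, -, hd, -⟩ := hT C hC
      exact (hH.injOn_and_map_eq hσ (h self_mem_cell) hd.ge).1
    rw [h0, Finset.sum_empty]
    refine (Finset.sum_eq_zero fun τ hτ => ?_).symm
    obtain ⟨hτX, ⟨hdτ, hQτ⟩, hτσ⟩ := Finset.mem_filter.1 hτ
    have hsp := hH.coneSpan_cell_le hσ (Set.image_mono Submodule.subset_span hQσ)
    have heq : coneSpan (cell H Q) = (coneSpan σ).map (realMap f) := by
      refine Submodule.eq_of_le_of_finrank_le hsp ?_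
      by_contra! hlt
      refine hinj (injOn_of_coneDim_le ?_)
      have : coneDim (cell H Q) = Module.finrank ℝ (coneSpan (cell H Q)) := rfl
      omega
    have h1 : latticeIncl Λ' (f (v τ)) ∈ coneSpan (cell H Q) := by
      rw [heq, ← realMap_latticeIncl]
      exact ⟨_, (hv τ hτX hdτ hτσ).mem, rfl⟩
    have h2 : (coneSpan (cell H Q)).mkQ (latticeIncl Λ' (f (v τ))) = 0 :=
      (Submodule.Quotient.mk_eq_zero _).2 h1
    rw [h2, smul_zero]
  obtain ⟨P, hP, hPQ⟩ := hQσ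
  by_cases hPi : P ∈ coneInterior σ
  · rw [hH.sum_cells_of_mem_coneInterior hσ hinj hdQ ⟨P, hPi, hPQ⟩ T u hT hT',
      Finset.filter_false_of_mem, Finset.sum_empty]
    rintro τ - ⟨⟨hdτ, P', hP', hPQ'⟩, hτσ⟩
    have : P' = P := hinj (Submodule.subset_span (hτσ.subset hP')) (Submodule.subset_span hP)
      (hPQ'.trans hPQ.symm)
    rw [hτσ.eq_of_mem_coneInterior (this ▸ hP') hPi] at hdτ
    omega
  · obtain ⟨τ, hτσ, hPτ, hne⟩ := hσc.exists_face_of_notMem_coneInterior hP hPi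
    have hτX := X.face_mem σ hσ τ hτσ
    have hdlt : coneDim τ < coneDim σ := by
      by_contra! h
      exact hne (hτσ.eq_of_coneDim_le h)
    have hQτ : Q ∈ realMap f '' τ := ⟨P, hPτ, hPQ⟩
    have hdle : coneDim (cell H Q) ≤ coneDim τ :=
      (Submodule.finrank_mono (hH.coneSpan_cell_le hτX
        (Set.image_mono Submodule.subset_span hQτ))).trans (finrank_map_coneSpan_le f τ)
    have hdτ : coneDim τ + 1 = coneDim σ := by omega
    have hfilter : X.cones.filter (fun τ => (coneDim τ + 1 = coneDim σ ∧ Q ∈ realMap f '' τ) ∧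
        IsFace τ σ) = {τ} := by
      ext ρ
      rw [Finset.mem_filter, Finset.mem_singleton]
      refine ⟨?_, ?_⟩
      · rintro ⟨hρX, ⟨hdρ, hQρ⟩, hρσ⟩
        have h1 := (hH.injOn_and_map_eq hτX hQτ (by omega)).2
        rw [(hH.injOn_and_map_eq hρX hQρ (by omega)).2] at h1
        have h2 : ∀ {ρ τ : Set (VSpace Λ)}, IsFace ρ σ → IsFace τ σ →
            (coneSpan ρ).map (realMap f) = (coneSpan τ).map (realMap f) →
            coneSpan ρ ≤ coneSpan τ := by
          intro ρ τ hρσ hτσ h x hx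
          have hmem : realMap f x ∈ (coneSpan τ).map (realMap f) := h ▸ ⟨x, hx, rfl⟩
          obtain ⟨y, hy, hxy⟩ := hmem
          rwa [← hinj (coneSpan_mono hτσ.subset hy) (coneSpan_mono hρσ.subset hx) hxy]
        have h3 := le_antisymm (h2 hρσ hτσ h1) (h2 hτσ hρσ h1.symm)
        rw [hρσ.eq_inter_coneSpan, hτσ.eq_inter_coneSpan, h3]
      · rintro rfl
        exact ⟨hτX, ⟨hdτ, hQτ⟩, hτσ⟩
    rw [hfilter, Finset.sum_singleton]
    exact hH.sum_cells_of_mem_facet hσ hinj hτX hτσ hdτ hdQ hQτ (hv τ hτX hdτ hτσ) T u hT hT'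

/-- The push-forward weights are balanced around each cell of codimension one. -/
theorem pushWeight_balanced (X : TropicalFan Λ n) (hH : IsAdapted H X.toFan f)
    (hdQ : coneDim (cell H Q) + 1 = n) (T : Finset (Set (VSpace Λ'))) (u : Set (VSpace Λ') → Λ')
    (hT : ∀ C ∈ T, (∃ p, C = cell H p) ∧ Q ∈ C ∧ coneDim C = n ∧
      IsNormalVector C (cell H Q) (u C))
    (hT' : ∀ p ∈ realMap f '' X.support, Q ∈ cell H p → coneDim (cell H p) = n →
      cell H p ∈ T) :
    ∑ C ∈ T, pushWeight X.toWeightedFan f C • latticeIncl Λ' (u C) ∈ coneSpan (cell H Q) := by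
  classical
  choose! v hv hvb using X.balanced
  have hv' : ∀ σ ∈ X.cones, coneDim σ = n → ∀ τ ∈ X.cones, coneDim τ + 1 = n → IsFace τ σ →
      IsNormalVector σ τ (v τ σ) := fun σ hσ hdσ τ hτ hdτ hτσ =>
    hv τ hτ hdτ σ (Finset.mem_filter.2 ⟨hσ, hdσ, hτσ⟩)
  set q := (coneSpan (cell H Q)).mkQ with hq
  suffices h : q (∑ C ∈ T, pushWeight X.toWeightedFan f C • latticeIncl Λ' (u C)) = 0 from
    (Submodule.Quotient.mk_eq_zero _).1 h
  calc q (∑ C ∈ T, pushWeight X.toWeightedFan f C • latticeIncl Λ' (u C))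
      = ∑ C ∈ T, ∑ σ ∈ X.cones with coneDim σ = n ∧ C ⊆ realMap f '' σ,
          X.weight σ • (latticeIndex f σ C • q (latticeIncl Λ' (u C))) := by
        rw [map_sum]
        refine Finset.sum_congr rfl fun C _ => ?_
        rw [map_nsmul, pushWeight, Finset.sum_smul]
        exact Finset.sum_congr rfl fun σ _ => mul_smul _ _ _
    _ = ∑ σ ∈ X.cones with coneDim σ = n, X.weight σ • ∑ C ∈ T with C ⊆ realMap f '' σ,
          latticeIndex f σ C • q (latticeIncl Λ' (u C)) := by
        simp_rw [Finset.smul_sum]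
        refine Finset.sum_comm' fun C σ => ?_
        simp only [Finset.mem_filter]
        tauto
    _ = ∑ σ ∈ X.cones with coneDim σ = n, X.weight σ •
          ∑ τ ∈ X.cones with (coneDim τ + 1 = n ∧ Q ∈ realMap f '' τ) ∧ IsFace τ σ,
          latticeIndex f τ (cell H Q) • q (latticeIncl Λ' (f (v τ σ))) := by
        refine Finset.sum_congr rfl fun σ hσ => ?_
        obtain ⟨hσ, hdσ⟩ := Finset.mem_filter.1 hσ
        congr 1
        refine hH.sum_cells_eq_sum_facets hdQ hσ hdσ T u hT (fun p hp => hT' p ?_)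
          (fun τ => v τ σ) (hv' σ hσ hdσ)
        obtain ⟨x, hx, rfl⟩ := hp
        exact ⟨x, ⟨σ, hσ, hx⟩, rfl⟩
    _ = ∑ τ ∈ X.cones with coneDim τ + 1 = n ∧ Q ∈ realMap f '' τ,
          latticeIndex f τ (cell H Q) • q (realMap f
            (∑ σ ∈ X.toFan.star n τ, X.weight σ • latticeIncl Λ (v τ σ))) := by
        simp_rw [map_sum, Finset.smul_sum]
        refine (Finset.sum_comm'
          (t' := X.cones.filter fun τ => coneDim τ + 1 = n ∧ Q ∈ realMap f '' τ)
          (s' := fun τ => X.toFan.star n τ) fun σ τ => ?_).trans ?_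
        · simp only [Finset.mem_filter, Fan.star]
          tauto
        · refine Finset.sum_congr rfl fun τ _ => Finset.sum_congr rfl fun σ _ => ?_
          rw [map_nsmul, map_nsmul, realMap_latticeIncl, smul_comm]
    _ = 0 := by
        refine Finset.sum_eq_zero fun τ hτ => ?_
        obtain ⟨hτ, hdτ, hQτ⟩ := Finset.mem_filter.1 hτ
        have h1 := (hH.injOn_and_map_eq hτ hQτ (by omega)).2
        have h2 : realMap f (∑ σ ∈ X.toFan.star n τ, X.weight σ • latticeIncl Λ (v τ σ)) ∈
            coneSpan (cell H Q) := by
          rw [h1]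
          exact ⟨_, hvb τ hτ hdτ, rfl⟩
        have h3 : q _ = 0 := (Submodule.Quotient.mk_eq_zero _).2 h2
        rw [h3, smul_zero]

end PushForward

/-! ### Tropical fans from balanced weights on cells -/

section FromWeights

variable {Λ : Type*} [AddCommGroup Λ] {n : ℕ}

theorem mem_star_cellFan {H : Finset (Module.Dual ℤ Λ)} {hH : IsSymmForms H}
    {S : Set (VSpace Λ)} {hS : IsCellClosed H S} {Q : VSpace Λ} {C : Set (VSpace Λ)} :
    C ∈ (cellFan H hH S hS).star n (cell H Q) ↔
      ∃ p ∈ S, C = cell H p ∧ coneDim C = n ∧ Q ∈ C := by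
  classical
  rw [Fan.star, Finset.mem_filter, mem_cellFan]
  constructor
  · rintro ⟨⟨p, hp, rfl⟩, hd, hQ⟩
    exact ⟨p, hp, rfl, hd, hQ.subset self_mem_cell⟩
  · rintro ⟨p, hp, rfl, hd, hQ⟩
    exact ⟨⟨p, hp, rfl⟩, hd, isFace_cell_of_mem hH hQ⟩

/-- Balanced nonnegative weights on the `n`-dimensional cells of an arrangement define a tropical
fan, whose support is the union of the cells of positive weight. -/
theorem exists_tropicalFan_of_balanced [Module.Finite ℤ Λ] {H : Finset (Module.Dual ℤ Λ)} (hH : IsSymmForms H)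
    {S : Set (VSpace Λ)} (hS : IsCellClosed H S) (hdim : ∀ p ∈ S, coneDim (cell H p) ≤ n)
    (d : Set (VSpace Λ) → ℕ) (hne : ∃ p ∈ S, coneDim (cell H p) = n ∧ 0 < d (cell H p))
    (hbal : ∀ Q ∈ S, coneDim (cell H Q) + 1 = n → ∃ u : Set (VSpace Λ) → Λ,
      (∀ C ∈ (cellFan H hH S hS).star n (cell H Q), IsNormalVector C (cell H Q) (u C)) ∧
      ∑ C ∈ (cellFan H hH S hS).star n (cell H Q), d C • latticeIncl Λ (u C) ∈
        coneSpan (cell H Q)) :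
    ∃ Z : TropicalFan Λ n, Z.support =
      {q | ∃ p ∈ S, q ∈ cell H p ∧ coneDim (cell H p) = n ∧ 0 < d (cell H p)} := by
  classical
  set S' := {q | ∃ p ∈ S, q ∈ cell H p ∧ coneDim (cell H p) = n ∧ 0 < d (cell H p)} with hS'
  have hS'S : S' ⊆ S := by
    rintro q ⟨p, hp, hq, -⟩
    exact hS p hp hq
  have hcl : IsCellClosed H S' := by
    rintro q ⟨p, hp, hq, h⟩ x hx
    exact ⟨p, hp, cell_subset_of_mem hq hx, h⟩
  have hpos : ∀ q ∈ S', coneDim (cell H q) = n → 0 < d (cell H q) := by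
    rintro q ⟨p, hp, hq, hd, h⟩ hdq
    rwa [cell_eq_of_coneDim_le hH hq (hd.trans hdq.symm).le]
  obtain ⟨p₀, hp₀, hd₀, hpos₀⟩ := hne
  have hp₀' : p₀ ∈ S' := ⟨p₀, hp₀, self_mem_cell, hd₀, hpos₀⟩
  let Z : TropicalFan Λ n :=
    { cellFan H hH S' hcl with
      dim_eq := by
        refine le_antisymm (Finset.sup_le fun σ hσ => ?_) ?_
        · obtain ⟨p, hp, rfl⟩ := mem_cellFan.1 hσ
          exact_mod_cast hdim p (hS'S hp)
        · have h1 := Finset.le_sup (f := fun σ : Set (VSpace Λ) => (coneDim σ : WithBot ℕ))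
            (mem_cellFan (hH := hH) (hS := hcl).2 ⟨p₀, hp₀', rfl⟩)
          exact hd₀ ▸ h1
      pure := by
        intro σ hσ
        obtain ⟨q, ⟨p, hp, hq, hd, h⟩, rfl⟩ := mem_cellFan.1 hσ.prop
        have h1 : cell H p ∈ (cellFan H hH S' hcl).cones :=
          mem_cellFan.2 ⟨p, ⟨p, hp, self_mem_cell, hd, h⟩, rfl⟩
        rw [Set.Subset.antisymm (cell_subset_of_mem hq) (hσ.le_of_ge h1 (cell_subset_of_mem hq))]
        exact hd
      weight := d
      weight_pos := by
        intro σ hσ hd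
        obtain ⟨q, hq, rfl⟩ := mem_cellFan.1 hσ
        exact hpos q hq hd
      balanced := by
        intro τ hτ hd
        obtain ⟨Q, hQ, rfl⟩ := mem_cellFan.1 hτ
        obtain ⟨u, hu, hsum⟩ := hbal Q (hS'S hQ) hd
        have hsub : (cellFan H hH S' hcl).star n (cell H Q) ⊆
            (cellFan H hH S hS).star n (cell H Q) := by
          intro C hC
          obtain ⟨p, hp, h⟩ := mem_star_cellFan.1 hC
          exact mem_star_cellFan.2 ⟨p, hS'S hp, h⟩
        refine ⟨u, fun σ hσ => hu σ (hsub hσ), ?_⟩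
        have heq : ∑ σ ∈ (cellFan H hH S' hcl).star n (cell H Q), d σ • latticeIncl Λ (u σ) =
            ∑ σ ∈ (cellFan H hH S hS).star n (cell H Q), d σ • latticeIncl Λ (u σ) := by
          refine Finset.sum_subset hsub fun C hC hC' => ?_
          obtain ⟨p, hp, rfl, hdp, hQp⟩ := mem_star_cellFan.1 hC
          have h0 : d (cell H p) = 0 := by
            by_contra hne
            exact hC' (mem_star_cellFan.2 ⟨p, ⟨p, hp, self_mem_cell, hdp,
              Nat.pos_of_ne_zero hne⟩, rfl, hdp, hQp⟩)
          rw [h0, zero_smul]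
        exact heq ▸ hsum }
  exact ⟨Z, support_cellFan (hH := hH) (hS := hcl)⟩

end FromWeights

/-! ### General points -/

section General

variable {Λ Λ' : Type*} [AddCommGroup Λ] [AddCommGroup Λ'] {n : ℕ}

@[simp]
theorem realMap_id : realMap (LinearMap.id : Λ →ₗ[ℤ] Λ) = LinearMap.id :=
  LinearMap.baseChange_id

theorem Fan.IsOpenCell.eq {X : Fan Λ} {P : VSpace Λ} {σ ρ : Set (VSpace Λ)}
    (hσ : X.IsOpenCell n P σ) (hρ : X.IsOpenCell n P ρ) : σ = ρ := by
  obtain ⟨h1, h2⟩ := X.inter_face σ hσ.1 ρ hρ.1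
  have hP : P ∈ σ ∩ ρ := ⟨hσ.2.2.1, hρ.2.2.1⟩
  exact (h1.eq_of_mem_coneInterior hP hσ.2.2).symm.trans (h2.eq_of_mem_coneInterior hP hρ.2.2)

theorem Fan.IsOpenCell.cellAt_eq {X : Fan Λ} {P : VSpace Λ} {σ : Set (VSpace Λ)}
    (hσ : X.IsOpenCell n P σ) : X.cellAt n P = σ :=
  Fan.IsOpenCell.eq (Classical.epsilon_spec (p := X.IsOpenCell n P) ⟨σ, hσ⟩) hσ

theorem latticeIndex_congr {f : Λ →ₗ[ℤ] Λ'} {σ : Set (VSpace Λ)} {C D : Set (VSpace Λ')}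
    (h : coneSpan C = coneSpan D) : latticeIndex f σ C = latticeIndex f σ D := by
  have h1 : coneLattice C = coneLattice D := by rw [coneLattice, h, coneLattice]
  rw [latticeIndex, latticeIndex, h1]

theorem IsAdapted.support_isCellClosed {H : Finset (Module.Dual ℤ Λ)} {Y : Fan Λ}
    (hH : IsAdapted H Y LinearMap.id) : IsCellClosed H Y.support := by
  rintro q ⟨σ, hσ, hq⟩ x hx
  have h1 := hH.image σ hσ (by rw [realMap_id]; exact Function.injective_id.injOn)
  rw [realMap_id, LinearMap.id_coe, Set.image_id] at h1
  exact ⟨σ, hσ, h1 q hq hx⟩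

variable [Module.Finite ℤ Λ] [Module.Finite ℤ Λ'] {H : Finset (Module.Dual ℤ Λ')}
  {X : WeightedFan Λ n} {f : Λ →ₗ[ℤ] Λ'}

/-- Over a point whose cell has full dimension `n`, each cone of `X` contains the preimages in its
interior and is mapped isomorphically to the span of the cell. -/
theorem IsAdapted.isOpenCell (hH : IsAdapted H X.toFan f) {P : VSpace Λ} {σ : Set (VSpace Λ)}
    (hσ : σ ∈ X.cones) (hP : P ∈ σ) (hd : coneDim (cell H (realMap f P)) = n) :
    X.toFan.IsOpenCell n P σ ∧ Set.InjOn (realMap f) (coneSpan σ) ∧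
      coneSpan (cell H (realMap f P)) = (coneSpan σ).map (realMap f) ∧
      cell H (realMap f P) ⊆ realMap f '' σ := by
  have hmem : realMap f P ∈ realMap f '' σ := ⟨P, hP, rfl⟩
  obtain ⟨hinj, heq⟩ := hH.injOn_and_map_eq hσ hmem ((X.coneDim_le hσ).trans hd.ge)
  have himg := hH.image σ hσ hinj _ hmem
  refine ⟨⟨hσ, ?_, hP, fun v hv => ?_⟩, hinj, heq, himg⟩
  · rw [← finrank_map_coneSpan_of_injOn hinj, ← heq]
    exact hd
  · obtain ⟨ε, hε, hmem⟩ := (self_mem_coneInterior_cell (p := realMap f P) hH.symm).2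
      (realMap f v) (by rw [heq]; exact ⟨v, hv, rfl⟩)
    obtain ⟨x, hx, hfx⟩ := himg hmem
    refine ⟨ε, hε, ?_⟩
    rwa [← hinj (Submodule.subset_span hx)
      (add_mem (Submodule.subset_span hP) (Submodule.smul_mem _ ε hv))
      (by rw [hfx, map_add, map_smul])]

/-- For the identity, the push-forward weight of a cell is the weight of the cone around it. -/
theorem IsAdapted.pushWeight_id {Y : WeightedFan Λ' n}
    (hH : IsAdapted H Y.toFan LinearMap.id) {Q : VSpace Λ'} (hQ : Q ∈ Y.support)
    (hd : coneDim (cell H Q) = n) :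
    pushWeight Y LinearMap.id (cell H Q) = Y.weight (Y.cellAt n Q) := by
  classical
  obtain ⟨σ, hσ, hQσ⟩ := hQ
  have key : ∀ σ ∈ Y.cones, Q ∈ σ → Y.toFan.IsOpenCell n Q σ ∧
      coneSpan (cell H Q) = coneSpan σ ∧ cell H Q ⊆ σ := by
    intro σ hσ hQσ
    have h1 := hH.isOpenCell hσ hQσ (by simpa using hd)
    simp only [realMap_id, LinearMap.id_coe, id_eq, Set.image_id', Submodule.map_id] at h1
    exact ⟨h1.1, h1.2.2⟩
  obtain ⟨hopen, hspan, hsub⟩ := key σ hσ hQσ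
  have hfilter : Y.cones.filter (fun ρ => coneDim ρ = n ∧
      cell H Q ⊆ realMap (LinearMap.id : Λ' →ₗ[ℤ] Λ') '' ρ) = {σ} := by
    ext ρ
    simp only [Finset.mem_filter, Finset.mem_singleton, realMap_id, LinearMap.id_coe, Set.image_id]
    constructor
    · rintro ⟨hρ, -, hQρ⟩
      exact (key ρ hρ (hQρ self_mem_cell)).1.eq hopen
    · rintro rfl
      exact ⟨hσ, hopen.2.1, hsub⟩
  rw [pushWeight, hfilter, Finset.sum_singleton, hopen.cellAt_eq, latticeIndex_congr hspan,
    latticeIndex, Submodule.map_id, AddSubgroup.relIndex_self, mul_one]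

/-- The points of a general fibre correspond to the top-dimensional cones whose image contains the
cell of the base point. -/
theorem IsAdapted.bijOn_fibre (hH : IsAdapted H X.toFan f) {Q : VSpace Λ'}
    (hd : coneDim (cell H Q) = n) :
    open Classical in
    Set.BijOn (X.cellAt n) (fibre X.toFan f Q)
      (X.cones.filter fun σ => coneDim σ = n ∧ cell H Q ⊆ realMap f '' σ) := by
  classical
  refine ⟨?_, ?_, ?_⟩
  · rintro P ⟨⟨σ, hσ, hP⟩, rfl⟩
    obtain ⟨h1, -, -, h2⟩ := hH.isOpenCell hσ hP hd
    rw [h1.cellAt_eq]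
    exact Finset.mem_coe.2 (Finset.mem_filter.2 ⟨hσ, h1.2.1, h2⟩)
  · rintro P ⟨⟨σ, hσ, hP⟩, rfl⟩ P' ⟨⟨σ', hσ', hP'⟩, hPP'⟩ heq
    obtain ⟨h1, hinj, -, -⟩ := hH.isOpenCell hσ hP hd
    obtain ⟨h1', -, -, -⟩ := hH.isOpenCell hσ' hP' (by rw [hPP']; exact hd)
    rw [h1.cellAt_eq, h1'.cellAt_eq] at heq
    subst heq
    exact hinj (Submodule.subset_span hP) (Submodule.subset_span hP') hPP'.symm
  · intro σ hσ
    obtain ⟨hσX, -, hsub⟩ := Finset.mem_filter.1 (Finset.mem_coe.1 hσ)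
    obtain ⟨P, hP, rfl⟩ := hsub self_mem_cell
    exact ⟨P, ⟨⟨σ, hσX, hP⟩, rfl⟩, (hH.isOpenCell hσX hP hd).1.cellAt_eq⟩

/-- The weighted count of preimages is the quotient of the push-forward weight by the weight of
the target. -/
theorem IsAdapted.finsum_mult (hH : IsAdapted H X.toFan f) {Y : WeightedFan Λ' n}
    {Q : VSpace Λ'} (hd : coneDim (cell H Q) = n)
    (hspan : coneSpan (Y.cellAt n Q) = coneSpan (cell H Q)) :
    ∑ᶠ P ∈ fibre X.toFan f Q, mult X Y f P =
      (pushWeight X f (cell H Q) : ℚ) / Y.weight (Y.cellAt n Q) := by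
  classical
  rw [finsum_mem_eq_of_bijOn (g := fun σ => (X.weight σ : ℚ) / Y.weight (Y.cellAt n Q) *
    latticeIndex f σ (cell H Q)) (X.cellAt n) (hH.bijOn_fibre hd), finsum_mem_coe_finset,
    pushWeight, Nat.cast_sum, Finset.sum_div]
  · refine Finset.sum_congr rfl fun σ _ => ?_
    push_cast
    ring
  · rintro P ⟨-, rfl⟩
    rw [mult, latticeIndex_congr hspan]

end General

/-! ### Irreducible targets -/

section Irreducible

variable {Λ Λ' : Type*} [AddCommGroup Λ] [AddCommGroup Λ'] [Module.Finite ℤ Λ]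
  [Module.Finite ℤ Λ'] {n : ℕ} {H : Finset (Module.Dual ℤ Λ')}

theorem IsAdapted.coneDim_cell_le {Y : WeightedFan Λ' n}
    (hH : IsAdapted H Y.toFan LinearMap.id) {Q : VSpace Λ'} (hQ : Q ∈ Y.support) :
    coneDim (cell H Q) ≤ n := by
  obtain ⟨σ, hσ, hQσ⟩ := hQ
  have h1 := hH.coneSpan_cell_le hσ (Q := Q)
    (by rw [realMap_id]; exact ⟨Q, Submodule.subset_span hQσ, rfl⟩)
  rw [realMap_id, Submodule.map_id] at h1
  exact (Submodule.finrank_mono h1).trans (Y.coneDim_le hσ)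

/-- On an irreducible target the push-forward weights are a constant multiple of the weights of the
target: subtracting the largest multiple that leaves nonnegative weights gives balanced weights that
vanish somewhere, hence everywhere. -/
theorem TropicalFan.Irreducible.exists_pushWeight_eq {X : TropicalFan Λ n} {Y : TropicalFan Λ' n}
    {f : Λ →ₗ[ℤ] Λ'} (hY : Y.Irreducible) (hf : IsMorphism X.toFan Y.toFan f)
    (hHX : IsAdapted H X.toFan f) (hHY : IsAdapted H Y.toFan LinearMap.id) :
    ∃ c : ℚ, ∀ Q ∈ Y.support, coneDim (cell H Q) = n →
      (pushWeight X.toWeightedFan f (cell H Q) : ℚ) = c * Y.weight (Y.cellAt n Q) := by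
  classical
  have hH := hHX.symm
  have hS := hHY.support_isCellClosed
  set a : Set (VSpace Λ') → ℕ := pushWeight X.toWeightedFan f with ha
  set b : Set (VSpace Λ') → ℕ := pushWeight Y.toWeightedFan LinearMap.id with hb
  have hbpos : ∀ Q ∈ Y.support, coneDim (cell H Q) = n → 0 < b (cell H Q) := by
    rintro Q ⟨σ, hσ, hQσ⟩ hd
    obtain ⟨h1, -⟩ := hHY.isOpenCell (X := Y.toWeightedFan) hσ hQσ (by simpa using hd)
    rw [hb, hHY.pushWeight_id ⟨σ, hσ, hQσ⟩ hd, h1.cellAt_eq]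
    exact Y.weight_pos σ hσ h1.2.1
  let N := (cellFan H hH Y.support hS).cones.filter fun C => coneDim C = n
  have hN : ∀ C, C ∈ N ↔ ∃ p ∈ Y.support, C = cell H p ∧ coneDim C = n := by
    intro C
    rw [Finset.mem_filter, mem_cellFan]
    tauto
  suffices h : ∃ c : ℚ, ∀ C ∈ N, (a C : ℚ) = c * b C by
    obtain ⟨c, hc⟩ := h
    refine ⟨c, fun Q hQ hd => ?_⟩
    rw [hc _ ((hN _).2 ⟨Q, hQ, rfl, hd⟩), hb, hHY.pushWeight_id hQ hd]
  rcases N.eq_empty_or_nonempty with hempty | hnonempty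
  · exact ⟨0, by simp [hempty]⟩
  obtain ⟨C₀, hC₀, hmin⟩ := N.exists_min_image (fun C => (a C : ℚ) / b C) hnonempty
  have hbN : ∀ C ∈ N, 0 < b C := by
    intro C hC
    obtain ⟨p, hp, rfl, hd⟩ := (hN C).1 hC
    exact hbpos p hp hd
  have hle : ∀ C ∈ N, a C₀ * b C ≤ a C * b C₀ := by
    intro C hC
    have h1 := hmin C hC
    rw [div_le_div_iff₀ (by exact_mod_cast hbN C₀ hC₀) (by exact_mod_cast hbN C hC)] at h1
    exact_mod_cast h1
  let d : Set (VSpace Λ') → ℕ := fun C => a C * b C₀ - a C₀ * b C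
  by_cases hd : ∀ C ∈ N, d C = 0
  · refine ⟨(a C₀ : ℚ) / b C₀, fun C hC => ?_⟩
    have h1 : a C * b C₀ = a C₀ * b C :=
      le_antisymm (Nat.sub_eq_zero_iff_le.1 (hd C hC)) (hle C hC)
    have h2 : (b C₀ : ℚ) ≠ 0 := by exact_mod_cast (hbN C₀ hC₀).ne'
    rw [div_mul_eq_mul_div, eq_div_iff h2]
    exact_mod_cast h1
  -- otherwise the difference is a tropical fan that misses the cell `C₀`
  exfalso
  push Not at hd
  obtain ⟨C₁, hC₁, hd₁⟩ := hd
  obtain ⟨p₁, hp₁, rfl, hdim₁⟩ := (hN C₁).1 hC₁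
  obtain ⟨Z, hZ⟩ := exists_tropicalFan_of_balanced hH hS
    (fun p hp => hHY.coneDim_cell_le (Y := Y.toWeightedFan) hp) d
    ⟨p₁, hp₁, hdim₁, Nat.pos_of_ne_zero hd₁⟩ (by
      intro Q hQ hdQ
      set T := (cellFan H hH Y.support hS).star n (cell H Q)
      have hTN : ∀ C ∈ T, C ∈ N := by
        intro C hC
        obtain ⟨p, hp, h1, h2, -⟩ := mem_star_cellFan.1 hC
        exact (hN C).2 ⟨p, hp, h1, h2⟩
      have hex : ∀ C ∈ T, ∃ w, IsNormalVector C (cell H Q) w := by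
        intro C hC
        obtain ⟨p, hp, rfl, h1, h2⟩ := mem_star_cellFan.1 hC
        exact exists_isNormalVector (isFace_cell_of_mem hH h2) (hdQ.trans h1.symm)
      choose! u hu using hex
      have hT : ∀ C ∈ T, (∃ p, C = cell H p) ∧ Q ∈ C ∧ coneDim C = n ∧
          IsNormalVector C (cell H Q) (u C) := by
        intro C hC
        obtain ⟨p, hp, h0, h1, h2⟩ := mem_star_cellFan.1 hC
        exact ⟨⟨p, h0⟩, h2, h1, hu C hC⟩
      refine ⟨u, hu, ?_⟩
      have hsumX := pushWeight_balanced X hHX hdQ T u hT (by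
        rintro _ ⟨x, hx, rfl⟩ hQp hdp
        exact mem_star_cellFan.2 ⟨_, hf x hx, rfl, hdp, hQp⟩)
      have hsumY := pushWeight_balanced Y hHY hdQ T u hT (by
        rintro p hp hQp hdp
        rw [realMap_id, LinearMap.id_coe, Set.image_id] at hp
        exact mem_star_cellFan.2 ⟨p, hp, rfl, hdp, hQp⟩)
      have heq : ∑ C ∈ T, d C • latticeIncl Λ' (u C) =
          b C₀ • ∑ C ∈ T, a C • latticeIncl Λ' (u C) -
            a C₀ • ∑ C ∈ T, b C • latticeIncl Λ' (u C) := by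
        rw [Finset.smul_sum, Finset.smul_sum, ← Finset.sum_sub_distrib]
        refine Finset.sum_congr rfl fun C hC => ?_
        rw [sub_nsmul _ (hle C (hTN C hC)), smul_smul, smul_smul, mul_comm (a C), sub_eq_add_neg]
      rw [heq]
      exact sub_mem (nsmul_mem hsumX _) (nsmul_mem hsumY _))
  obtain ⟨p₀, hp₀, rfl, hdim₀⟩ := (hN C₀).1 hC₀
  refine hY ⟨Z, ?_⟩
  rw [hZ, Set.ssubset_iff_of_subset]
  · refine ⟨p₀, hp₀, ?_⟩
    rintro ⟨p, hp, hmem, hdp, hdpos⟩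
    rw [← cell_eq_of_coneDim_le hH hmem (hdp.trans hdim₀.symm).le] at hdpos
    simp [d] at hdpos
  · rintro q ⟨p, hp, hq, -⟩
    exact hS p hp hq

end Irreducible

end TropicalFans

theorem corollary2p26 {Λ Λ' : Type*}
    [AddCommGroup Λ] [Module.Free ℤ Λ] [Module.Finite ℤ Λ]
    [AddCommGroup Λ'] [Module.Free ℤ Λ'] [Module.Finite ℤ Λ']
    (n : ℕ) (X : TropicalFans.TropicalFan Λ n) (Y : TropicalFans.TropicalFan Λ' n)
    (f : Λ →ₗ[ℤ] Λ') (hf : TropicalFans.IsMorphism X.toFan Y.toFan f)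
    (hY : Y.Irreducible) :
    ∃ Y₀ : TropicalFans.Fan Λ', Y₀.dim < (n : WithBot ℕ) ∧ Y₀.support ⊆ Y.support ∧
      -- every general point of the target lies in the interior of a cone of dimension `n`
      (∀ Q ∈ Y.support \ Y₀.support, ∃! σ', Y.IsOpenCell n Q σ') ∧
      -- so does each of its preimages
      (∀ P ∈ X.support, TropicalFans.realMap f P ∈ Y.support \ Y₀.support →
        ∃! σ, X.IsOpenCell n P σ) ∧
      -- the lattice indices in the multiplicities are finite, the sums have finitely many terms
      (∀ P ∈ X.support, TropicalFans.realMap f P ∈ Y.support \ Y₀.support →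
        (TropicalFans.coneLattice (X.cellAt n P)).map f ≤
            TropicalFans.coneLattice (Y.cellAt n (TropicalFans.realMap f P)) ∧
          TropicalFans.latticeIndex f (X.cellAt n P)
            (Y.cellAt n (TropicalFans.realMap f P)) ≠ 0) ∧
      (∀ Q ∈ Y.support \ Y₀.support, (TropicalFans.fibre X.toFan f Q).Finite) ∧
      -- the weighted count of the preimages is the same for all general points
      (∃ c : ℚ, ∀ Q ∈ Y.support \ Y₀.support,
        ∑ᶠ P ∈ TropicalFans.fibre X.toFan f Q,
          TropicalFans.mult X.toWeightedFan Y.toWeightedFan f P = c) := by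
  classical
  open TropicalFans in
  obtain ⟨H₁, h₁⟩ := exists_isAdapted X.toFan f
  obtain ⟨H₂, h₂⟩ := exists_isAdapted Y.toFan LinearMap.id
  have hsymm := isSymmForms_union h₁.symm h₂.symm
  have hHX := h₁.mono Finset.subset_union_left hsymm
  have hHY := h₂.mono Finset.subset_union_right hsymm
  clear h₁ h₂
  set H := H₁ ∪ H₂
  have hS := hHY.support_isCellClosed
  let Y₀ : Fan Λ' := cellFan H hsymm {p ∈ Y.support | coneDim (cell H p) < n}
    fun q hq x hx => ⟨hS q hq.1 hx, (coneDim_mono (cell_subset_of_mem hx)).trans_lt hq.2⟩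
  have hsupp : Y₀.support = {p ∈ Y.support | coneDim (cell H p) < n} := support_cellFan
  have hgen : ∀ Q ∈ Y.support \ Y₀.support, coneDim (cell H Q) = n := by
    rintro Q ⟨hQ, hQ₀⟩
    rw [hsupp] at hQ₀
    exact le_antisymm (hHY.coneDim_cell_le (Y := Y.toWeightedFan) hQ)
      (not_lt.1 fun h => hQ₀ ⟨hQ, h⟩)
  have hYcell : ∀ Q ∈ Y.support \ Y₀.support, ∃ σ', Y.IsOpenCell n Q σ' ∧
      coneSpan σ' = coneSpan (cell H Q) := by
    intro Q hQ
    obtain ⟨σ, hσ, hQσ⟩ := hQ.1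
    obtain ⟨h1, -, h2, -⟩ := hHY.isOpenCell (X := Y.toWeightedFan) hσ hQσ
      (by simpa using hgen Q hQ)
    rw [realMap_id, Submodule.map_id] at h2
    exact ⟨σ, h1, h2.symm⟩
  have hYspan : ∀ Q ∈ Y.support \ Y₀.support, coneSpan (Y.cellAt n Q) = coneSpan (cell H Q) := by
    intro Q hQ
    obtain ⟨σ', h1, h2⟩ := hYcell Q hQ
    rw [h1.cellAt_eq, h2]
  refine ⟨Y₀, ?_, ?_, fun Q hQ => ?_, fun P hP hQ => ?_, fun P hP hQ => ?_, fun Q hQ => ?_, ?_⟩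
  · refine (Finset.sup_lt_iff (WithBot.bot_lt_coe n)).2 fun σ hσ => ?_
    obtain ⟨p, hp, rfl⟩ := mem_cellFan.1 hσ
    exact WithBot.coe_lt_coe.2 hp.2
  · rw [hsupp]
    exact Set.sep_subset _ _
  · obtain ⟨σ', h1, -⟩ := hYcell Q hQ
    exact ⟨σ', h1, fun ρ hρ => hρ.eq h1⟩
  · obtain ⟨σ, hσ, hPσ⟩ := hP
    obtain ⟨h1, -⟩ := hHX.isOpenCell (X := X.toWeightedFan) hσ hPσ (hgen _ hQ)
    exact ⟨σ, h1, fun ρ hρ => hρ.eq h1⟩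
  · obtain ⟨σ, hσ, hPσ⟩ := hP
    obtain ⟨h1, -, h2, -⟩ := hHX.isOpenCell (X := X.toWeightedFan) hσ hPσ (hgen _ hQ)
    rw [h1.cellAt_eq]
    rw [← hYspan _ hQ] at h2
    exact ⟨map_coneLattice_le h2.ge, latticeIndex_ne_zero (X.isCone σ hσ) h2.symm⟩
  · exact (hHX.bijOn_fibre (X := X.toWeightedFan) (hgen Q hQ)).finite_iff_finite.2
      (Finset.finite_toSet _)
  · obtain ⟨c, hc⟩ := hY.exists_pushWeight_eq hf hHX hHY
    refine ⟨c, fun Q hQ => ?_⟩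
    rw [hHX.finsum_mult (X := X.toWeightedFan) (hgen Q hQ) (hYspan Q hQ), hc Q hQ.1 (hgen Q hQ)]
    obtain ⟨σ', h1, -⟩ := hYcell Q hQ
    refine mul_div_cancel_right₀ c ?_
    rw [h1.cellAt_eq]
    exact_mod_cast (Y.weight_pos σ' h1.1 h1.2.1).ne'
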